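/- Let $(\epsilon_t)_{t\ge 0}$ be a strictly stationary and ergodic process on a probability space, with values in a measurable sample space (for instance $\mathbb R^N$), adapted to a filtration $(\mathcal F_t)$ (nonanticipative). Let $\Theta\subset\mathbb R^d$ be convex with nonempty interior (not necessarily compact), and let $l$ be a loss function, measurable in its first argument, such that for every point $x$ of the sample space the map $\theta\mapsto l(x;\theta)$ is strictly convex and $C^\infty$ on $\Theta$ (derivatives at boundary points are taken within $\Theta$). Assume: (i) for every $\theta\in\Theta$, $l(\epsilon_t;\theta)$ is integrable, and $\theta\mapsto\mathbb E[l(\epsilon_t;\theta)]$ is uniquely minimized over $\Theta$ at $\theta_0\in\Theta$; (ii) $(\nabla_\theta l(\epsilon_t;\theta_0))_{t\ge1}$ is a square integrable martingale difference with respect to $(\mathcal F_t)$; (iii) $\mathbb H:=\mathbb E[\nabla^2_{\theta\theta'}l(\epsilon_t;\theta_0)]$ exists and is positive definite. The coordinates $\{1,\dots,d\}$ are partitioned into groups $\mathcal G_1,\dots,\mathcal G_m$, and $\theta^{(k)}=(\theta_i)_{i\in\mathcal G_k}$. Let $\lambda_T,\gamma_T\ge 0$ be deterministic tuning parameters and let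 $\alpha_k,\xi_l\ge0$ be deterministic weights (which may depend on $T$). For every $T\ge 1$ let $\hat\theta=\hat\theta_T$ be, almost surely, a minimizer over $\Theta$ of the penalized criterion $$\frac1T\sum_{t=1}^T l(\epsilon_t;\theta)+\frac{\lambda_T}{T}\sum_{k=1}^m\alpha_k\|\theta^{(k)}\|_1+\frac{\gamma_T}{T}\sum_{l=1}^m\xi_l\|\theta^{(l)}\|_2 .$$ Let $\mathcal A=\{j:\theta_{0,j}\ne0\}$, $a_T=\operatorname{card}(\mathcal A)\max_k\alpha_k$, $b_T=\operatorname{card}(\mathcal A)\max_l\xi_l$ and $$\nu_T=T^{-1/2}+\lambda_TT^{-1}a_T+\gamma_TT^{-1}b_T .$$ Assume the third-order moment condition: for some fixed constant $C>0$, with $$\upsilon_t(C)=\sup_{i,j,k}\ \sup_{\theta\in\Theta,\ \|\theta-\theta_0\|_2\le \nu_TC}|\partial^3_{\theta_i\theta_j\theta_k}l(\epsilon_t;\theta)|,$$ one has $\frac1{T^2}\sum_{t,t'=1}^T\mathbb E[\upsilon_t(C)\upsilon_{t'}(C)]<\infty$ for all sufficiently large $T$. If $\lambda_T=o(T)$,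 $\gamma_T=o(T)$, $\lambda_TT^{-1}a_T\to0$ and $\gamma_TT^{-1}b_T\to0$, then $$\|\hat\theta-\theta_0\|_2=O_p\big(T^{-1/2}+\lambda_TT^{-1}a_T+\gamma_TT^{-1}b_T\big),$$ that is, for every $\delta>0$ there is $K>0$ such that $\mathbb P(\|\hat\theta_T-\theta_0\|_2>K\nu_T)\le\delta$ for all sufficiently large $T$. -/

import Mathlib

open MeasureTheory ProbabilityTheory Filter Topology Asymptotics
open scoped ENNReal

namespace SGL

/-- The parameter space `ℝ^d` with its Euclidean norm. -/
abbrev Param (d : ℕ) : Type := EuclideanSpace ℝ (Fin d)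

/-- The set of active indices `𝒜 = {j : θ₀ j ≠ 0}`. -/
noncomputable def activeSet {d : ℕ} (θ₀ : Param d) : Finset (Fin d) :=
  Finset.univ.filter (fun j => θ₀ j ≠ 0)

/-- `‖θ^(k)‖₁`. The non-overlapping groups are the fibres of `grp : Fin d → Fin m`, that is
`𝒢_k = {i : grp i = k}`. -/
noncomputable def groupL1 {d m : ℕ} (grp : Fin d → Fin m) (k : Fin m) (θ : Param d) : ℝ :=
  ∑ i ∈ Finset.univ.filter (fun i => grp i = k), |θ i|

/-- `‖θ^(k)‖₂`. -/
noncomputable def groupL2 {d m : ℕ} (grp : Fin d → Fin m) (k : Fin m) (θ : Param d) : ℝ :=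
  Real.sqrt (∑ i ∈ Finset.univ.filter (fun i => grp i = k), (θ i) ^ 2)

/-- The `ℓ¹` penalty `p₁ = λ T⁻¹ ∑ₖ αₖ ‖θ^(k)‖₁`. -/
noncomputable def penaltyL1 {d m : ℕ} (grp : Fin d → Fin m) (T : ℕ) (lam : ℝ) (α : Fin m → ℝ)
    (θ : Param d) : ℝ :=
  lam * (T : ℝ)⁻¹ * ∑ k, α k * groupL1 grp k θ

/-- The `ℓ¹/ℓ²` penalty `p₂ = γ T⁻¹ ∑ₗ ξₗ ‖θ^(l)‖₂`. -/
noncomputable def penaltyL2 {d m : ℕ} (grp : Fin d → Fin m) (T : ℕ) (gam : ℝ) (ξ : Fin m → ℝ)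
    (θ : Param d) : ℝ :=
  gam * (T : ℝ)⁻¹ * ∑ k, ξ k * groupL2 grp k θ

/-- The empirical criterion `𝔾_T l(θ) = T⁻¹ ∑_{t=1}^T l(ε_t; θ)` along a path `x` of the process. -/
noncomputable def empCriterion {X : Type*} {d : ℕ} (l : X → Param d → ℝ) (x : ℕ → X) (T : ℕ)
    (θ : Param d) : ℝ :=
  (T : ℝ)⁻¹ * ∑ t ∈ Finset.Icc 1 T, l (x t) θ

/-- The penalized Sparse-Group LASSO criterion `𝔾_T φ(θ)`. -/
noncomputable def sglCriterion {X : Type*} {d m : ℕ} (grp : Fin d → Fin m)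
    (l : X → Param d → ℝ) (x : ℕ → X) (T : ℕ) (lam gam : ℝ) (α ξ : Fin m → ℝ)
    (θ : Param d) : ℝ :=
  empCriterion l x T θ + penaltyL1 grp T lam α θ + penaltyL2 grp T gam ξ θ

/-- `card(𝒜) · maxₖ wₖ`; this is `a_T` for `w = α` and `b_T` for `w = ξ`. -/
noncomputable def activeWeight {d m : ℕ} (θ₀ : Param d) (w : Fin m → ℝ) : ℝ :=
  ((activeSet θ₀).card : ℝ) * ⨆ k, w k

/-- The rate `ν_T = T^{-1/2} + λ_T T⁻¹ a_T + γ_T T⁻¹ b_T`. -/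
noncomputable def sglRate {d m : ℕ} (θ₀ : Param d) (lam gam : ℕ → ℝ) (α ξ : ℕ → Fin m → ℝ)
    (T : ℕ) : ℝ :=
  (T : ℝ) ^ (-(1 / 2) : ℝ) + lam T * (T : ℝ)⁻¹ * activeWeight θ₀ (α T)
    + gam T * (T : ℝ)⁻¹ * activeWeight θ₀ (ξ T)

/-- The partial derivative `∂f/∂θ_i` on the parameter set `Θ` (one-sided at boundary points). It is
used for convex `Θ` with nonempty interior, where derivatives within `Θ` are unique. -/
noncomputable def pderiv {d : ℕ} (Θ : Set (Param d)) (i : Fin d) (f : Param d → ℝ) :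
    Param d → ℝ :=
  fun θ => fderivWithin ℝ f Θ θ (EuclideanSpace.single i 1)

/-- `sup_{i,j,k} sup_{θ ∈ Θ, ‖θ - θ₀‖ ≤ r} |∂³f/∂θ_i∂θ_j∂θ_k (θ)|`, in `[0, ∞]`. -/
noncomputable def thirdOrderSup {d : ℕ} (Θ : Set (Param d)) (θ₀ : Param d) (r : ℝ)
    (f : Param d → ℝ) : ℝ≥0∞ :=
  ⨆ (i : Fin d) (j : Fin d) (k : Fin d) (θ : Param d) (_ : θ ∈ Θ ∩ Metric.closedBall θ₀ r),
    ENNReal.ofReal |pderiv Θ i (pderiv Θ j (pderiv Θ k f)) θ|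

/-- `T⁻² ∑_{t,t'=1}^T E[υ_t υ_{t'}]` in `[0, ∞]`, where `υ_t` is the supremum of the third-order
partial derivatives of `l(ε_t; ·)` over the ball of radius `r` around `θ₀`. -/
noncomputable def thirdOrderMoment {Ω X : Type*} [MeasurableSpace Ω] (P : Measure Ω) {d : ℕ}
    (Θ : Set (Param d)) (θ₀ : Param d) (l : X → Param d → ℝ) (ε : ℕ → Ω → X) (T : ℕ) (r : ℝ) :
    ℝ≥0∞ :=
  (∑ t ∈ Finset.Icc 1 T, ∑ s ∈ Finset.Icc 1 T,
    ∫⁻ ω, thirdOrderSup Θ θ₀ r (l (ε t ω)) * thirdOrderSup Θ θ₀ r (l (ε s ω)) ∂P) / (T : ℝ≥0∞) ^ 2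

/-- Strict stationarity and ergodicity of a process `ε`: the shift on path space preserves the law
of the process and is ergodic for it. -/
def StationaryErgodic {Ω X : Type*} [MeasurableSpace Ω] [MeasurableSpace X] (P : Measure Ω)
    (ε : ℕ → Ω → X) : Prop :=
  Ergodic (fun (x : ℕ → X) (t : ℕ) => x (t + 1)) (P.map (fun ω t => ε t ω))

/-- `(Y_t)_{t ≥ 1}` is a real square-integrable martingale difference with respect to `ℱ`. -/
def IsSqIntMartingaleDiff {Ω : Type*} [mΩ : MeasurableSpace Ω] (P : Measure Ω)
    (ℱ : Filtration ℕ mΩ) (Y : ℕ → Ω → ℝ) : Prop :=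
  ∀ t : ℕ, 1 ≤ t → Measurable[ℱ t] (Y t) ∧ MemLp (Y t) 2 P ∧ P[Y t | ℱ (t - 1)] =ᵐ[P] 0

/-- `θ₀` is the unique minimizer over `Θ` of `θ ↦ E[l(ε_t; θ)]` (for every `t`). -/
def IsTrueParameter {Ω X : Type*} [MeasurableSpace Ω] (P : Measure Ω) {d : ℕ}
    (Θ : Set (Param d)) (l : X → Param d → ℝ) (ε : ℕ → Ω → X) (θ₀ : Param d) : Prop :=
  θ₀ ∈ Θ ∧ ∀ t : ℕ, 1 ≤ t →
    (∀ θ ∈ Θ, Integrable (fun ω => l (ε t ω) θ) P) ∧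
    ∀ θ ∈ Θ, θ ≠ θ₀ → ∫ ω, l (ε t ω) θ₀ ∂P < ∫ ω, l (ε t ω) θ ∂P

/-- `ℍ = E[∇²l(ε_t; θ₀)]`, with `t` as a parameter. -/
noncomputable def expHessian {Ω X : Type*} [MeasurableSpace Ω] (P : Measure Ω) {d : ℕ}
    (Θ : Set (Param d)) (l : X → Param d → ℝ) (ε : ℕ → Ω → X) (θ₀ : Param d) (t : ℕ) :
    Matrix (Fin d) (Fin d) ℝ :=
  Matrix.of fun i j => ∫ ω, pderiv Θ i (pderiv Θ j (l (ε t ω))) θ₀ ∂P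

/-- `Y_T = O_p(r_T)`: for every `δ > 0` there is `K > 0` such that `P(|Y_T| > K r_T) ≤ δ` for all
large `T`. -/
def IsBigOp {Ω : Type*} [MeasurableSpace Ω] (P : Measure Ω) (Y : ℕ → Ω → ℝ) (r : ℕ → ℝ) : Prop :=
  ∀ δ : ℝ, 0 < δ → ∃ K : ℝ, 0 < K ∧
    ∀ᶠ T in atTop, P {ω | K * r T < |Y T ω|} ≤ ENNReal.ofReal δ

end SGL

/-!
The argument compares the penalized criterion at its minimizer and at `θ₀`. Write
`R_T(θ)` for the average over `1 ≤ t ≤ T` of the remainder of the first-order expansion of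
`l(ε_t; ·)` at `θ₀`.

* Inactive coordinates and groups do not contribute to the penalties at `θ₀`, so moving from `θ₀` to
  `θ` lowers the penalties by at most `(λ_T T⁻¹ a_T + γ_T T⁻¹ b_T) ‖θ - θ₀‖`. Hence the estimator
  satisfies `R_T(θ̂) ≤ s ‖θ̂ - θ₀‖`, where `s` is the size of the empirical score plus this slope
  (`empRemainder_le_of_isMinOn`). The score is `O_p(T^{-1/2})`, because martingale differences are
  orthogonal (`measure_average_ge_le`), so `s = O_p(ν_T)`.
* On a fixed ball around `θ₀`, with probability close to one, `R_T(θ) ≥ c ‖θ - θ₀‖²`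
  (`quadratic_growth`). The quadratic part of `R_T` is the empirical Hessian at `θ₀`, which
  converges in probability to a positive definite matrix by the mean ergodic theorem in `L¹`
  (`tendsto_birkhoffAverage_L1`). What `R_T` lacks compared with its quadratic part is the `defect`.
  Convexity makes the remainder nonnegative, so the defect is dominated by the Hessian at `θ₀`,
  which is integrable; by Taylor's formula it vanishes as the radius shrinks. Its mean is therefore
  small on a small ball (`tendsto_lintegral_defectSup`), and Markov's inequality applies.
* `R_T` is convex along segments issuing from `θ₀`, so the two bounds localize the estimator without
  a compactness assumption: `c ‖θ̂ - θ₀‖ ≤ s` as soon as `s` is small compared with the radius of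
  the ball (`norm_sub_le_of_quadratic_growth`).

Stationarity only speaks of measurable functions on the sample space. The derivatives of the loss
at `θ₀`, which may be a boundary point of `Θ`, are such functions by `measurable_pderiv`.
-/

namespace SGL

/-! ### The mean ergodic theorem in `L¹` -/

section MeanErgodic

variable {Y : Type*} [MeasurableSpace Y] {μ : Measure Y} [IsProbabilityMeasure μ] {S : Y → Y}

/-- Von Neumann's theorem in `L²`: for an ergodic map the fixed vectors are the constants. -/
theorem exists_tendsto_birkhoffAverage_L2 (hS : Ergodic S μ) (f : Lp ℝ 2 μ) :
    ∃ c : ℝ, Tendsto (birkhoffAverage ℝ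
      (Lp.compMeasurePreserving S hS.toMeasurePreserving : Lp ℝ 2 μ → Lp ℝ 2 μ) id · f)
      atTop (𝓝 (Lp.const 2 μ c)) := by
  set U : Lp ℝ 2 μ →L[ℝ] Lp ℝ 2 μ :=
    (Lp.compMeasurePreservingₗᵢ ℝ S hS.toMeasurePreserving).toContinuousLinearMap with hU
  have h := U.tendsto_birkhoffAverage_orthogonalProjection
    (LinearIsometry.norm_toContinuousLinearMap_le _) f
  set g := (U.eqLocus (1 : Lp ℝ 2 μ →L[ℝ] Lp ℝ 2 μ)).orthogonalProjectionOnto f with hg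
  have hfix : U (g : Lp ℝ 2 μ) = (g : Lp ℝ 2 μ) := g.2
  obtain ⟨c, hc⟩ := hS.eq_const_of_compMeasurePreserving_eq (congrArg Subtype.val hfix)
  refine ⟨c, ?_⟩
  have : (g : Lp ℝ 2 μ) = Lp.const 2 μ c := Subtype.ext hc
  rw [this] at h
  exact h

/-- The inclusion of `L²` in `L¹` of a probability space. -/
noncomputable def inclL2L1 (μ : Measure Y) [IsProbabilityMeasure μ] : Lp ℝ 2 μ →+ Lp ℝ 1 μ :=
  AddSubgroup.inclusion (Lp.antitone one_le_two)

theorem continuous_inclL2L1 : Continuous (inclL2L1 μ) := by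
  refine AddMonoidHomClass.continuous_of_bound (inclL2L1 μ) 1 fun f => ?_
  rw [one_mul, Lp.norm_def, Lp.norm_def]
  refine ENNReal.toReal_mono (Lp.eLpNorm_ne_top f) ?_
  exact eLpNorm_le_eLpNorm_of_exponent_le one_le_two (Lp.aestronglyMeasurable f)

/-- The mean ergodic theorem in `L¹`. The convergence extends from indicators, which lie in `L²`,
because the averages are uniformly Lipschitz on `L¹`. -/
theorem tendsto_birkhoffAverage_L1 (hS : Ergodic S μ) (f : Lp ℝ 1 μ) :
    Tendsto (birkhoffAverage ℝ
      (Lp.compMeasurePreserving S hS.toMeasurePreserving : Lp ℝ 1 μ → Lp ℝ 1 μ) id · f)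
      atTop (𝓝 (Lp.const 1 μ (∫ x, f x ∂μ))) := by
  set U : Lp ℝ 1 μ →+ Lp ℝ 1 μ := Lp.compMeasurePreserving S hS.toMeasurePreserving with hU
  have hUint : ∀ h : Lp ℝ 1 μ, ∫ x, U h x ∂μ = ∫ x, h x ∂μ := by
    intro h
    rw [integral_congr_ae (Lp.coeFn_compMeasurePreserving h hS.toMeasurePreserving)]
    have := integral_map (μ := μ) (φ := S) hS.measurable.aemeasurable (f := h)
      (by rw [hS.map_eq]; exact Lp.aestronglyMeasurable h)
    rw [hS.map_eq] at this
    exact this.symm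
  have hIcont : Continuous fun h : Lp ℝ 1 μ => ∫ x, h x ∂μ := continuous_integral
  have hIadd : ∀ g h : Lp ℝ 1 μ, ∫ x, (g + h : Lp ℝ 1 μ) x ∂μ = ∫ x, g x ∂μ + ∫ x, h x ∂μ := by
    intro g h
    rw [integral_congr_ae (Lp.coeFn_add g h)]
    exact integral_add (L1.integrable_coeFn g) (L1.integrable_coeFn h)
  let I : Lp ℝ 1 μ →+ ℝ := AddMonoidHom.mk' (fun h => ∫ x, h x ∂μ) hIadd
  refine Lp.induction (p := 1) ENNReal.one_ne_top
    (motive := fun f => Tendsto (birkhoffAverage ℝ U id · f) atTop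
      (𝓝 (Lp.const 1 μ (∫ x, f x ∂μ)))) ?_ ?_ ?_ f
  · intro c s hs hμs
    set y : Lp ℝ 2 μ := indicatorConstLp 2 hs hμs.ne c
    have hy : ((Lp.simpleFunc.indicatorConst 1 hs hμs.ne c : Lp.simpleFunc ℝ 1 μ) : Lp ℝ 1 μ)
        = inclL2L1 μ y := by
      rw [Lp.simpleFunc.coe_indicatorConst]
      rfl
    rw [hy]
    obtain ⟨a, ha⟩ := exists_tendsto_birkhoffAverage_L2 hS y
    have h1 := (continuous_inclL2L1.tendsto _).comp ha
    have h2 : ∀ n, inclL2L1 μ (birkhoffAverage ℝ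
        (Lp.compMeasurePreserving S hS.toMeasurePreserving : Lp ℝ 2 μ → Lp ℝ 2 μ) id n y)
        = birkhoffAverage ℝ U id n (inclL2L1 μ y) := by
      intro n
      rw [map_birkhoffAverage ℝ ℝ (inclL2L1 μ)]
      simp only [birkhoffAverage, birkhoffSum, Function.comp, id]
      congr 1
      refine Finset.sum_congr rfl fun k _ => ?_
      exact (Function.Semiconj.iterate_right (f := inclL2L1 μ) (ga := Lp.compMeasurePreserving S
        hS.toMeasurePreserving) (gb := U) (fun _ => rfl) k) y
    have h3 : Tendsto (birkhoffAverage ℝ U id · (inclL2L1 μ y)) atTop (𝓝 (Lp.const 1 μ a)) := by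
      refine Tendsto.congr h2 ?_
      exact h1
    -- averaging preserves the integral, so the limiting constant is the mean
    have h4 : Tendsto (fun n => I (birkhoffAverage ℝ U id n (inclL2L1 μ y))) atTop
        (𝓝 (∫ x, (Lp.const 1 μ a) x ∂μ)) := (hIcont.tendsto _).comp h3
    have h5 : ∀ᶠ n in atTop, I (birkhoffAverage ℝ U id n (inclL2L1 μ y))
        = ∫ x, inclL2L1 μ y x ∂μ := by
      filter_upwards [eventually_gt_atTop 0] with n hn
      rw [map_birkhoffAverage ℝ ℝ I]
      have hinv : ∀ k h, I (U^[k] h) = I h := by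
        intro k h
        induction k with
        | zero => rfl
        | succ k ih => rw [Function.iterate_succ_apply', ← ih]; exact hUint _
      simp only [birkhoffAverage, birkhoffSum, Function.comp, id, hinv]
      have hn' : (n : ℝ) ≠ 0 := by positivity
      simp only [Finset.sum_const, Finset.card_range, nsmul_eq_mul, smul_eq_mul,
        inv_mul_cancel_left₀ hn']
      rfl
    have h6 := tendsto_nhds_unique h4 (tendsto_const_nhds.congr' (h5.mono fun _ h => h.symm))
    rw [integral_congr_ae (Lp.coeFn_const 1 μ a)] at h6
    simp only [Function.const_apply, integral_const, probReal_univ, one_smul] at h6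
    rw [← h6]
    exact h3
  · intro f g hf hg _ h1 h2
    rw [hIadd, map_add]
    refine (h1.add h2).congr fun n => ?_
    simp [birkhoffAverage, birkhoffSum, Finset.sum_add_distrib, smul_add]
  · exact isClosed_setOfPred_tendsto_birkhoffAverage ℝ
      (Lp.isometry_compMeasurePreserving hS.toMeasurePreserving).lipschitz uniformContinuous_id
      ((Lp.constL 1 μ ℝ).continuous.comp hIcont)

/-- Averages of an integrable function along an ergodic map converge in probability to its mean. -/
theorem Ergodic.tendstoInMeasure_birkhoffAverage (hS : Ergodic S μ) {f : Y → ℝ}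
    (hf : Integrable f μ) :
    TendstoInMeasure μ (fun n => birkhoffAverage ℝ S f n) atTop fun _ => ∫ x, f x ∂μ := by
  have h := tendsto_birkhoffAverage_L1 hS (hf.toL1 f)
  rw [integral_congr_ae hf.coeFn_toL1] at h
  refine (tendstoInMeasure_of_tendsto_Lp h).congr (fun n => ?_) (Lp.coeFn_const 1 μ _)
  have key : ∀ k : ℕ, ((Lp.compMeasurePreserving S hS.toMeasurePreserving)^[k] (hf.toL1 f) :
      Lp ℝ 1 μ) =ᵐ[μ] f ∘ S^[k] := by
    intro k
    rw [Lp.compMeasurePreserving_iterate]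
    refine (Lp.coeFn_compMeasurePreserving _ _).trans ?_
    exact (hS.toMeasurePreserving.iterate k).quasiMeasurePreserving.ae_eq_comp hf.coeFn_toL1
  have hsum : ∀ n : ℕ, (birkhoffSum
      (Lp.compMeasurePreserving S hS.toMeasurePreserving : Lp ℝ 1 μ → Lp ℝ 1 μ) id n
      (hf.toL1 f) : Lp ℝ 1 μ) =ᵐ[μ] birkhoffSum S f n := by
    intro n
    induction n with
    | zero => simpa using Lp.coeFn_zero ℝ 1 μ
    | succ n ih =>
      rw [birkhoffSum_succ]
      filter_upwards [Lp.coeFn_add (birkhoffSum (Lp.compMeasurePreserving S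
        hS.toMeasurePreserving : Lp ℝ 1 μ → Lp ℝ 1 μ) id n (hf.toL1 f))
        (id ((Lp.compMeasurePreserving S hS.toMeasurePreserving)^[n] (hf.toL1 f))), ih, key n]
        with x h1 h2 h3
      rw [h1, Pi.add_apply, h2, birkhoffSum_succ]
      simp only [id]
      rw [h3]
      rfl
  simp only [birkhoffAverage]
  refine (Lp.coeFn_smul _ _).trans ?_
  filter_upwards [hsum n] with x hx
  rw [Pi.smul_apply, hx]
  rfl

end MeanErgodic

/-! ### Stationary ergodic processes -/

section Stationary

variable {Ω X : Type*} [MeasurableSpace Ω] [MeasurableSpace X] {P : Measure Ω} {ε : ℕ → Ω → X}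

/-- A stationary process has the same law at all times. -/
theorem StationaryErgodic.map_eq (h : StationaryErgodic P ε) (hε : ∀ t, Measurable (ε t)) (t : ℕ) :
    P.map (ε t) = P.map (ε 0) := by
  have hpath : Measurable fun ω t => ε t ω := measurable_pi_lambda _ hε
  have hcoord : ∀ s, P.map (ε s) = (P.map fun ω t => ε t ω).map fun x : ℕ → X => x s := fun s => by
    rw [Measure.map_map (measurable_pi_apply s) hpath]
    rfl
  induction t with
  | zero => rfl
  | succ t ih =>
    have hpres := h.toMeasurePreserving
    rw [← ih, hcoord t, hcoord (t + 1), ← hpres.map_eq,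
      Measure.map_map (measurable_pi_apply t) hpres.measurable, hpres.map_eq]
    rfl

/-- The weak law of large numbers for a stationary ergodic process. -/
theorem StationaryErgodic.tendsto_measure_average [IsProbabilityMeasure P]
    (h : StationaryErgodic P ε) (hε : ∀ t, Measurable (ε t)) {f : X → ℝ} (hf : Measurable f)
    (hint : Integrable (fun ω => f (ε 1 ω)) P) {η : ℝ} (hη : 0 < η) :
    Tendsto (fun T : ℕ => P {ω | η ≤ |(T : ℝ)⁻¹ * ∑ t ∈ Finset.Icc 1 T, f (ε t ω)
      - ∫ ω, f (ε 1 ω) ∂P|}) atTop (𝓝 0) := by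
  have hpath : Measurable fun ω t => ε t ω := measurable_pi_lambda _ hε
  have hprob : IsProbabilityMeasure (P.map fun ω t => ε t ω) :=
    Measure.isProbabilityMeasure_map hpath.aemeasurable
  set F : (ℕ → X) → ℝ := fun x => f (x 1) with hF
  have hFm : Measurable F := hf.comp (measurable_pi_apply 1)
  have hFint : Integrable F (P.map fun ω t => ε t ω) :=
    (integrable_map_measure hFm.aestronglyMeasurable hpath.aemeasurable).2 hint
  have hmean : ∫ x, F x ∂(P.map fun ω t => ε t ω) = ∫ ω, f (ε 1 ω) ∂P :=
    integral_map hpath.aemeasurable hFm.aestronglyMeasurable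
  have hlim := tendstoInMeasure_iff_norm.1 (Ergodic.tendstoInMeasure_birkhoffAverage h hFint) η hη
  refine hlim.congr fun T => ?_
  have hiter : ∀ (k : ℕ) (x : ℕ → X),
      (fun (x : ℕ → X) (t : ℕ) => x (t + 1))^[k] x = fun t => x (t + k) := by
    intro k
    induction k with
    | zero => intro x; rfl
    | succ k ih =>
      intro x
      rw [Function.iterate_succ_apply, ih]
      funext t
      rw [show t + (k + 1) = t + k + 1 by ring]
  have havg : ∀ x : ℕ → X, birkhoffAverage ℝ (fun (x : ℕ → X) (t : ℕ) => x (t + 1)) F T x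
      = (T : ℝ)⁻¹ * ∑ t ∈ Finset.Icc 1 T, f (x t) := by
    intro x
    simp only [birkhoffAverage, birkhoffSum, hiter, hF, smul_eq_mul]
    congr 1
    rw [Finset.range_eq_Ico, Finset.sum_congr rfl fun k _ => by rw [add_comm 1 k],
      Finset.sum_Ico_add' (fun t => f (x t)) 0 T 1]
    rfl
  have hmeas : Measurable fun x : ℕ → X => (T : ℝ)⁻¹ * ∑ t ∈ Finset.Icc 1 T, f (x t) :=
    (Finset.measurable_sum _ fun t _ => hf.comp (measurable_pi_apply t)).const_mul _
  simp only [havg, hmean, Real.norm_eq_abs]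
  rw [Measure.map_apply hpath
    (measurableSet_le measurable_const (hmeas.sub_const _).abs)]
  rfl

end Stationary

/-! ### Partial derivatives within the parameter set -/

section Derivatives

variable {d : ℕ} {Θ : Set (Param d)} {θ₀ : Param d} {f : Param d → ℝ}

theorem map_eq_sum_single {F : Type*} [NormedAddCommGroup F] [NormedSpace ℝ F]
    (A : Param d →L[ℝ] F) (w : Param d) : A w = ∑ i, w i • A (EuclideanSpace.single i 1) := by
  have hw : w = ∑ i, w i • (EuclideanSpace.single i (1 : ℝ) : Param d) := by
    ext j
    simp [Finset.sum_apply, Pi.single_apply]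
  conv_lhs => rw [hw]
  simp [map_sum]

theorem fderivWithin_apply_eq_sum (θ w : Param d) :
    fderivWithin ℝ f Θ θ w = ∑ i, w i * pderiv Θ i f θ :=
  map_eq_sum_single _ w

theorem contDiffOn_pderiv (hΘ : UniqueDiffOn ℝ Θ)
    (hf : ContDiffOn ℝ ((⊤ : ℕ∞) : WithTop ℕ∞) f Θ) (i : Fin d) :
    ContDiffOn ℝ ((⊤ : ℕ∞) : WithTop ℕ∞) (pderiv Θ i f) Θ :=
  (hf.fderivWithin hΘ (m := ((⊤ : ℕ∞) : WithTop ℕ∞)) le_rfl).clm_apply contDiffOn_const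

/-- The derivative within a convex set, in a feasible direction, is the limit of difference
quotients. -/
theorem tendsto_diffQuot (hΘ : Convex ℝ Θ) (hf : DifferentiableWithinAt ℝ f Θ θ₀) (hθ : θ₀ ∈ Θ)
    {w : Param d} (hw : θ₀ + w ∈ Θ) :
    Tendsto (fun n : ℕ => ((n : ℝ) + 1) * (f (θ₀ + ((n : ℝ) + 1)⁻¹ • w) - f θ₀)) atTop
      (𝓝 (fderivWithin ℝ f Θ θ₀ w)) := by
  refine hf.hasFDerivWithinAt.lim (c := fun n : ℕ => (n : ℝ) + 1) ?_
    (Eventually.of_forall fun n => ?_) ?_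
  · have h0 : Tendsto (fun n : ℕ => ((n : ℝ) + 1)⁻¹) atTop (𝓝 0) := by
      simpa using tendsto_one_div_add_atTop_nhds_zero_nat (𝕜 := ℝ)
    simpa using h0.smul_const w
  · exact hΘ.add_smul_mem hθ hw
      ⟨by positivity, inv_le_one_of_one_le₀ (by linarith [Nat.cast_nonneg (α := ℝ) n])⟩
  · refine tendsto_const_nhds.congr fun n => ?_
    rw [smul_smul, mul_inv_cancel₀ (by positivity), one_smul]

/-- Measurability of derivatives within a convex body, also at its boundary points: along feasible
directions the derivative is a limit of difference quotients, and every vector is a multiple of a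
difference of two feasible directions. -/
theorem measurable_pderiv {X : Type*} [MeasurableSpace X] (hΘ : Convex ℝ Θ)
    (hint : (interior Θ).Nonempty) {g : X → Param d → ℝ}
    (hmeas : ∀ θ ∈ Θ, Measurable fun x => g x θ) (hg : ∀ x, DifferentiableOn ℝ (g x) Θ)
    (hθ : θ₀ ∈ Θ) (i : Fin d) : Measurable fun x => pderiv Θ i (g x) θ₀ := by
  have hfeas : ∀ w : Param d, θ₀ + w ∈ Θ → Measurable fun x => fderivWithin ℝ (g x) Θ θ₀ w := by
    intro w hw
    refine measurable_of_tendsto_metrizable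
      (f := fun (n : ℕ) x => ((n : ℝ) + 1) * (g x (θ₀ + ((n : ℝ) + 1)⁻¹ • w) - g x θ₀))
      (fun n => ((hmeas _ ?_).sub (hmeas _ hθ)).const_mul _)
      (tendsto_pi_nhds.2 fun x => tendsto_diffQuot hΘ (hg x θ₀ hθ) hθ hw)
    exact hΘ.add_smul_mem hθ hw
      ⟨by positivity, inv_le_one_of_one_le₀ (by linarith [Nat.cast_nonneg (α := ℝ) n])⟩
  -- The direction from `θ₀` to an interior point is feasible, and so are its small perturbations.
  obtain ⟨c, hc⟩ := hint
  have hev : ∀ᶠ s : ℝ in 𝓝[>] 0, c + s • (EuclideanSpace.single i (1 : ℝ) : Param d) ∈ Θ := by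
    have hcont : Continuous fun s : ℝ => c + s • (EuclideanSpace.single i (1 : ℝ) : Param d) := by
      fun_prop
    have h0 : (fun s : ℝ => c + s • (EuclideanSpace.single i (1 : ℝ) : Param d)) 0
        ∈ interior Θ := by
      simpa using hc
    filter_upwards [nhdsWithin_le_nhds (hcont.continuousAt (isOpen_interior.mem_nhds h0))]
      with s hs using interior_subset hs
  obtain ⟨s, hs, hs0⟩ := (hev.and self_mem_nhdsWithin).exists
  have hs0 : (0 : ℝ) < s := hs0
  have h1 := hfeas (c - θ₀) (by simpa using interior_subset hc)
  have h2 := hfeas (c - θ₀ + s • EuclideanSpace.single i (1 : ℝ)) (by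
    rw [show θ₀ + (c - θ₀ + s • (EuclideanSpace.single i (1 : ℝ) : Param d))
      = c + s • EuclideanSpace.single i (1 : ℝ) by abel]
    exact hs)
  convert (h2.sub h1).const_mul s⁻¹ using 2 with x
  simp only [pderiv, Pi.sub_apply, map_add, map_smul, smul_eq_mul]
  field_simp
  ring

/-- The remainder of the first-order expansion of `f` at `θ₀`. -/
noncomputable def remainder (Θ : Set (Param d)) (θ₀ : Param d) (f : Param d → ℝ) (θ : Param d) :
    ℝ :=
  f θ - f θ₀ - ∑ i, (θ i - θ₀ i) * pderiv Θ i f θ₀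

/-- The quadratic form of the second derivative of `f` at `θ₀`. -/
noncomputable def hessQuad (Θ : Set (Param d)) (θ₀ : Param d) (f : Param d → ℝ) (u : Param d) :
    ℝ :=
  ∑ i, ∑ j, u i * u j * pderiv Θ i (pderiv Θ j f) θ₀

/-- The sum of the absolute values of the second partial derivatives of `f` at `θ₀`. -/
noncomputable def hessSize (Θ : Set (Param d)) (θ₀ : Param d) (f : Param d → ℝ) : ℝ :=
  ∑ i, ∑ j, |pderiv Θ i (pderiv Θ j f) θ₀|

theorem remainder_eq (θ : Param d) :
    remainder Θ θ₀ f θ = f θ - f θ₀ - fderivWithin ℝ f Θ θ₀ (θ - θ₀) := by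
  rw [fderivWithin_apply_eq_sum]
  rfl

theorem remainder_self : remainder Θ θ₀ f θ₀ = 0 := by simp [remainder]

theorem abs_coord_le (u : Param d) (i : Fin d) : |u i| ≤ ‖u‖ := by
  simpa using PiLp.norm_apply_le u i

theorem hessQuad_le (u : Param d) : hessQuad Θ θ₀ f u ≤ ‖u‖ ^ 2 * hessSize Θ θ₀ f := by
  rw [hessQuad, hessSize, Finset.mul_sum]
  refine Finset.sum_le_sum fun i _ => ?_
  rw [Finset.mul_sum]
  refine Finset.sum_le_sum fun j _ => ?_
  calc _ ≤ |u i * u j * pderiv Θ i (pderiv Θ j f) θ₀| := le_abs_self _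
    _ = |u i| * |u j| * |pderiv Θ i (pderiv Θ j f) θ₀| := by rw [abs_mul, abs_mul]
    _ ≤ _ := by
      rw [sq]
      gcongr <;> exact abs_coord_le u _

theorem hessQuad_eq (hΘ : UniqueDiffOn ℝ Θ) (hθ : θ₀ ∈ Θ)
    (hf : ContDiffOn ℝ ((⊤ : ℕ∞) : WithTop ℕ∞) f Θ) (u : Param d) :
    hessQuad Θ θ₀ f u = fderivWithin ℝ (fderivWithin ℝ f Θ) Θ θ₀ u u := by
  have hD : DifferentiableWithinAt ℝ (fderivWithin ℝ f Θ) Θ θ₀ :=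
    (hf.fderivWithin hΘ (m := ((⊤ : ℕ∞) : WithTop ℕ∞)) le_rfl).differentiableOn (by simp) θ₀ hθ
  have hcoord : ∀ i j, pderiv Θ i (pderiv Θ j f) θ₀ = fderivWithin ℝ (fderivWithin ℝ f Θ) Θ θ₀
      (EuclideanSpace.single i 1) (EuclideanSpace.single j 1) := by
    intro i j
    have h := hD.hasFDerivWithinAt.clm_apply (hasFDerivWithinAt_const
      (EuclideanSpace.single j (1 : ℝ) : Param d) θ₀ Θ)
    change fderivWithin ℝ (fun θ => fderivWithin ℝ f Θ θ (EuclideanSpace.single j 1)) Θ θ₀ _ = _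
    rw [h.fderivWithin (hΘ θ₀ hθ)]
    simp
  rw [map_eq_sum_single (fderivWithin ℝ (fderivWithin ℝ f Θ) Θ θ₀ u)]
  simp only [hessQuad, hcoord]
  rw [map_eq_sum_single (fderivWithin ℝ (fderivWithin ℝ f Θ) Θ θ₀) u, Finset.sum_comm]
  refine Finset.sum_congr rfl fun j _ => ?_
  simp only [_root_.sum_apply, smul_apply, smul_eq_mul, Finset.mul_sum]
  exact Finset.sum_congr rfl fun i _ => by ring

/-- Second-order Taylor expansion within a convex set: the mean value inequality along the segment
from `θ₀`, where the first derivative is differentiable only within `Θ`. -/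
theorem exists_abs_remainder_sub_le (hconv : Convex ℝ Θ) (hΘ : UniqueDiffOn ℝ Θ) (hθ : θ₀ ∈ Θ)
    (hf : ContDiffOn ℝ ((⊤ : ℕ∞) : WithTop ℕ∞) f Θ) {η : ℝ} (hη : 0 < η) :
    ∃ ρ > 0, ∀ θ ∈ Θ, ‖θ - θ₀‖ < ρ →
      |remainder Θ θ₀ f θ - hessQuad Θ θ₀ f (θ - θ₀) / 2| ≤ η * ‖θ - θ₀‖ ^ 2 := by
  set F := fderivWithin ℝ f Θ with hF
  set B := fderivWithin ℝ F Θ θ₀ with hB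
  have hD : HasFDerivWithinAt F B Θ θ₀ :=
    ((hf.fderivWithin hΘ (m := ((⊤ : ℕ∞) : WithTop ℕ∞)) le_rfl).differentiableOn
      (by simp) θ₀ hθ).hasFDerivWithinAt
  have hdiff : DifferentiableOn ℝ f Θ := hf.differentiableOn (by simp)
  have hbd := hD.isLittleO.def hη
  obtain ⟨ρ, hρ, hball⟩ := Metric.mem_nhdsWithin_iff.1 hbd
  refine ⟨ρ, hρ, fun θ hθΘ hlt => ?_⟩
  set u := θ - θ₀ with hu
  have hmem : ∀ s ∈ Set.Icc (0 : ℝ) 1, θ₀ + s • u ∈ Θ := fun s hs =>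
    hconv.add_smul_sub_mem hθ hθΘ hs
  have hder : ∀ s ∈ Set.Icc (0 : ℝ) 1, HasDerivWithinAt
      (fun s : ℝ => f (θ₀ + s • u) - s * F θ₀ u - s ^ 2 / 2 * B u u)
      (F (θ₀ + s • u) u - F θ₀ u - s * B u u) (Set.Icc 0 1) s := by
    intro s hs
    have hline : HasDerivWithinAt (fun s : ℝ => θ₀ + s • u) u (Set.Icc 0 1) s := by
      simpa using ((hasDerivWithinAt_id s (Set.Icc (0 : ℝ) 1)).smul_const u).const_add θ₀
    have h1 : HasDerivWithinAt (fun s : ℝ => f (θ₀ + s • u)) (F (θ₀ + s • u) u) (Set.Icc 0 1) s :=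
      ((hdiff _ (hmem s hs)).hasFDerivWithinAt).comp_hasDerivWithinAt s hline hmem
    have h2 : HasDerivWithinAt (fun s : ℝ => s * F θ₀ u) (F θ₀ u) (Set.Icc 0 1) s := by
      simpa using (hasDerivWithinAt_id s (Set.Icc (0 : ℝ) 1)).mul_const (F θ₀ u)
    have h3 : HasDerivWithinAt (fun s : ℝ => s ^ 2 / 2 * B u u) (s * B u u) (Set.Icc 0 1) s := by
      have := (((hasDerivAt_id s).pow 2).div_const 2).mul_const (B u u)
      refine (this.hasDerivWithinAt).congr_deriv ?_
      simp
    exact (h1.sub h2).sub h3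
  have hbound : ∀ s ∈ Set.Icc (0 : ℝ) 1,
      ‖F (θ₀ + s • u) u - F θ₀ u - s * B u u‖ ≤ η * ‖u‖ ^ 2 := by
    intro s hs
    have hsu : ‖s • u‖ ≤ ‖u‖ := by
      rw [norm_smul, Real.norm_of_nonneg hs.1]
      exact mul_le_of_le_one_left (norm_nonneg _) hs.2
    have hin : θ₀ + s • u ∈ Metric.ball θ₀ ρ ∩ Θ :=
      ⟨by rw [mem_ball_iff_norm, add_sub_cancel_left]; exact hsu.trans_lt hlt, hmem s hs⟩
    have h := hball hin
    simp only [Set.mem_ofPred_eq, add_sub_cancel_left] at h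
    have hval : F (θ₀ + s • u) u - F θ₀ u - s * B u u
        = (F (θ₀ + s • u) - F θ₀ - B (s • u)) u := by
      simp
    rw [hval]
    calc _ ≤ ‖F (θ₀ + s • u) - F θ₀ - B (s • u)‖ * ‖u‖ := ContinuousLinearMap.le_opNorm _ _
      _ ≤ η * ‖u‖ * ‖u‖ := by
        refine mul_le_mul_of_nonneg_right (h.trans ?_) (norm_nonneg _)
        exact mul_le_mul_of_nonneg_left hsu hη.le
      _ = η * ‖u‖ ^ 2 := by ring
  have hmv := (convex_Icc (0 : ℝ) 1).norm_image_sub_le_of_norm_hasDerivWithin_le hder hbound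
    (Set.left_mem_Icc.2 zero_le_one) (Set.right_mem_Icc.2 zero_le_one)
  rw [remainder_eq, hessQuad_eq hΘ hθ hf]
  simp only [sub_zero, norm_one, mul_one, one_smul, zero_smul, add_zero, one_mul, zero_mul,
    one_pow, Real.norm_eq_abs] at hmv
  convert hmv using 2
  rw [show θ₀ + u = θ by rw [hu]; abel]
  ring

/-- Convexity bounds the remainder along the segment from `θ₀` to `θ` linearly. -/
theorem remainder_segment_le (hf : ConvexOn ℝ Θ f) (hθ : θ₀ ∈ Θ) {θ : Param d} (hmem : θ ∈ Θ)
    {s : ℝ} (hs : s ∈ Set.Icc (0 : ℝ) 1) :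
    remainder Θ θ₀ f (θ₀ + s • (θ - θ₀)) ≤ s * remainder Θ θ₀ f θ := by
  have h := hf.2 hθ hmem (sub_nonneg.2 hs.2) hs.1 (sub_add_cancel 1 s)
  have hpt : (1 - s) • θ₀ + s • θ = θ₀ + s • (θ - θ₀) := by
    rw [sub_smul, one_smul, smul_sub]; abel
  rw [hpt] at h
  simp only [smul_eq_mul] at h
  rw [remainder_eq, remainder_eq, add_sub_cancel_left, map_smul, smul_eq_mul]
  linarith

theorem remainder_nonneg (hf : ConvexOn ℝ Θ f) (hdiff : DifferentiableWithinAt ℝ f Θ θ₀)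
    (hθ : θ₀ ∈ Θ) {θ : Param d} (hmem : θ ∈ Θ) : 0 ≤ remainder Θ θ₀ f θ := by
  have hw : θ₀ + (θ - θ₀) ∈ Θ := by simpa using hmem
  have hlim := tendsto_diffQuot hf.1 hdiff hθ hw
  rw [remainder_eq, sub_nonneg]
  refine le_of_tendsto' hlim fun n => ?_
  have hn : (0 : ℝ) < (n : ℝ) + 1 := by positivity
  have h := remainder_segment_le hf hθ hmem (s := ((n : ℝ) + 1)⁻¹)
    ⟨by positivity, inv_le_one_of_one_le₀ (by linarith [Nat.cast_nonneg (α := ℝ) n])⟩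
  rw [remainder_eq, remainder_eq, add_sub_cancel_left, map_smul, smul_eq_mul] at h
  have h2 : f (θ₀ + ((n : ℝ) + 1)⁻¹ • (θ - θ₀)) - f θ₀ ≤ ((n : ℝ) + 1)⁻¹ * (f θ - f θ₀) := by
    linarith
  calc _ ≤ ((n : ℝ) + 1) * (((n : ℝ) + 1)⁻¹ * (f θ - f θ₀)) := by gcongr
    _ = f θ - f θ₀ := mul_inv_cancel_left₀ hn.ne' _

end Derivatives

/-! ### The curvature defect -/

section Defect

variable {d : ℕ} {Θ : Set (Param d)} {θ₀ : Param d} {f : Param d → ℝ}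

/-- How much the remainder falls short of its quadratic approximation, relative to
`‖θ - θ₀‖ ^ 2` (zero at `θ₀`). -/
noncomputable def defect (Θ : Set (Param d)) (θ₀ : Param d) (f : Param d → ℝ) (θ : Param d) : ℝ :=
  (hessQuad Θ θ₀ f (θ - θ₀) / 2 - remainder Θ θ₀ f θ) / ‖θ - θ₀‖ ^ 2

/-- The supremum of the positive part of the defect over the points of `S` at distance less than
`ρ` from `θ₀`. In the applications `S` is a countable dense subset of `Θ`, which makes this
measurable in a parameter of `f`. -/
noncomputable def defectSup (Θ : Set (Param d)) (θ₀ : Param d) (S : Set (Param d)) (ρ : ℝ)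
    (f : Param d → ℝ) : ℝ≥0∞ :=
  ⨆ θ ∈ S ∩ Metric.ball θ₀ ρ, ENNReal.ofReal (defect Θ θ₀ f θ)

theorem hessSize_nonneg : 0 ≤ hessSize Θ θ₀ f :=
  Finset.sum_nonneg fun _ _ => Finset.sum_nonneg fun _ _ => abs_nonneg _

/-- By convexity the defect is dominated by the Hessian at `θ₀`. -/
theorem defect_le_hessSize (hf : ConvexOn ℝ Θ f) (hdiff : DifferentiableWithinAt ℝ f Θ θ₀)
    (hθ : θ₀ ∈ Θ) {θ : Param d} (hmem : θ ∈ Θ) : defect Θ θ₀ f θ ≤ hessSize Θ θ₀ f := by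
  have h1 := remainder_nonneg hf hdiff hθ hmem
  have h2 := hessQuad_le (Θ := Θ) (θ₀ := θ₀) (f := f) (θ - θ₀)
  have h3 := mul_nonneg (sq_nonneg ‖θ - θ₀‖) (hessSize_nonneg (Θ := Θ) (θ₀ := θ₀) (f := f))
  refine div_le_of_le_mul₀ (by positivity) hessSize_nonneg ?_
  linarith

theorem defectSup_le_hessSize (hf : ConvexOn ℝ Θ f) (hdiff : DifferentiableWithinAt ℝ f Θ θ₀)
    (hθ : θ₀ ∈ Θ) {S : Set (Param d)} (hS : S ⊆ Θ) (ρ : ℝ) :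
    defectSup Θ θ₀ S ρ f ≤ ENNReal.ofReal (hessSize Θ θ₀ f) :=
  iSup₂_le fun _ h => ENNReal.ofReal_le_ofReal (defect_le_hessSize hf hdiff hθ (hS h.1))

theorem hessQuad_continuous : Continuous (hessQuad Θ θ₀ f) := by
  unfold hessQuad
  fun_prop

/-- The supremum over a dense subset of `Θ` bounds the defect on all of `Θ`. -/
theorem ofReal_defect_le (hcont : ContinuousOn f Θ) {S : Set (Param d)} (hS : S ⊆ Θ)
    (hdense : Θ ⊆ closure S) {ρ : ℝ} {θ : Param d} (hmem : θ ∈ Θ) (hball : ‖θ - θ₀‖ < ρ) :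
    ENNReal.ofReal (defect Θ θ₀ f θ) ≤ defectSup Θ θ₀ S ρ f := by
  rcases eq_or_ne θ θ₀ with rfl | hne
  · simp [defect]
  have hrem : ContinuousWithinAt (remainder Θ θ₀ f) Θ θ :=
    ((hcont θ hmem).sub continuousWithinAt_const).sub
      (Continuous.continuousWithinAt (by fun_prop))
  have hdef : ContinuousWithinAt (defect Θ θ₀ f) Θ θ := by
    refine ContinuousWithinAt.div (ContinuousWithinAt.sub ?_ hrem) ?_ ?_
    · exact ((hessQuad_continuous.comp (continuous_id.sub continuous_const)).div_const
        2).continuousWithinAt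
    · exact Continuous.continuousWithinAt (by fun_prop)
    · exact pow_ne_zero _ (norm_ne_zero_iff.2 (sub_ne_zero.2 hne))
  have hlim : Tendsto (fun θ => ENNReal.ofReal (defect Θ θ₀ f θ)) (𝓝[S] θ)
      (𝓝 (ENNReal.ofReal (defect Θ θ₀ f θ))) :=
    ENNReal.tendsto_ofReal (hdef.mono hS)
  have : (𝓝[S] θ).NeBot := mem_closure_iff_nhdsWithin_neBot.1 (hdense hmem)
  refine le_of_tendsto hlim ?_
  have hopen : Metric.ball θ₀ ρ ∈ 𝓝 θ :=
    Metric.isOpen_ball.mem_nhds (by rwa [mem_ball_iff_norm])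
  filter_upwards [self_mem_nhdsWithin, nhdsWithin_le_nhds hopen] with θ' h1 h2
  exact le_iSup₂_of_le θ' ⟨h1, h2⟩ le_rfl

theorem tendsto_defectSup (hconv : Convex ℝ Θ) (hΘ : UniqueDiffOn ℝ Θ) (hθ : θ₀ ∈ Θ)
    (hf : ContDiffOn ℝ ((⊤ : ℕ∞) : WithTop ℕ∞) f Θ) {S : Set (Param d)} (hS : S ⊆ Θ) :
    Tendsto (fun n : ℕ => defectSup Θ θ₀ S ((n : ℝ) + 1)⁻¹ f) atTop (𝓝 0) := by
  rw [ENNReal.tendsto_nhds_zero]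
  intro a ha
  obtain ⟨η, hη, hηa⟩ := ENNReal.lt_iff_exists_real_btwn.1 ha
  have hη0 : 0 < η := by simpa using hηa.1
  obtain ⟨ρ, hρ, hb⟩ := exists_abs_remainder_sub_le hconv hΘ hθ hf hη0
  have h0 : Tendsto (fun n : ℕ => ((n : ℝ) + 1)⁻¹) atTop (𝓝 0) := by
    simpa using tendsto_one_div_add_atTop_nhds_zero_nat (𝕜 := ℝ)
  filter_upwards [h0.eventually_lt_const hρ] with n hn
  refine le_trans (iSup₂_le fun θ h => ENNReal.ofReal_le_ofReal ?_) hηa.2.le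
  have h1 := hb θ (hS h.1) ((mem_ball_iff_norm.1 h.2).trans hn)
  refine div_le_of_le_mul₀ (by positivity) hη0.le ?_
  linarith [neg_abs_le (remainder Θ θ₀ f θ - hessQuad Θ θ₀ f (θ - θ₀) / 2)]

end Defect

/-! ### The penalties -/

section Penalty

variable {d m : ℕ} {grp : Fin d → Fin m} {θ₀ : Param d}

theorem activeWeight_nonneg {w : Fin m → ℝ} (hw : ∀ k, 0 ≤ w k) : 0 ≤ activeWeight θ₀ w :=
  mul_nonneg (Nat.cast_nonneg _) (Real.iSup_nonneg hw)

theorem weight_le_iSup (w : Fin m → ℝ) (k : Fin m) : w k ≤ ⨆ k, w k :=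
  le_ciSup (Set.finite_range w).bddAbove k

/-- A sum of group terms that is at most `w k * r` per active coordinate of the group `k` is at most
`activeWeight θ₀ w * r`. -/
theorem sum_le_activeWeight_mul {w : Fin m → ℝ} {r : ℝ} (hr : 0 ≤ r) {D : Fin m → ℝ}
    (hD : ∀ k, D k ≤ ((activeSet θ₀).filter fun i => grp i = k).card * (w k * r)) :
    ∑ k, D k ≤ activeWeight θ₀ w * r := by
  have hcard : ((activeSet θ₀).card : ℝ)
      = ∑ k, (((activeSet θ₀).filter fun i => grp i = k).card : ℝ) := by
    exact_mod_cast Finset.card_eq_sum_card_fiberwise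
      fun i _ => Finset.mem_coe.2 (Finset.mem_univ (grp i))
  rw [activeWeight, hcard, mul_assoc, Finset.sum_mul]
  refine Finset.sum_le_sum fun k _ => (hD k).trans ?_
  gcongr
  exact weight_le_iSup w k

/-- Inactive coordinates contribute nothing to the penalty at `θ₀`. -/
theorem groupL1_sub_le (k : Fin m) (θ : Param d) :
    groupL1 grp k θ₀ - groupL1 grp k θ
      ≤ ((activeSet θ₀).filter fun i => grp i = k).card * ‖θ - θ₀‖ := by
  have hfilter : (activeSet θ₀).filter (fun i => grp i = k)
      = (Finset.univ.filter fun i => grp i = k).filter fun i => θ₀ i ≠ 0 := by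
    rw [activeSet, Finset.filter_filter, Finset.filter_filter]
    simp only [and_comm]
  rw [groupL1, groupL1, ← Finset.sum_sub_distrib, hfilter, ← nsmul_eq_mul, ← Finset.sum_const,
    Finset.sum_filter (s := Finset.univ.filter fun i => grp i = k)]
  refine Finset.sum_le_sum fun i _ => ?_
  split_ifs with h
  · have h1 := abs_coord_le (θ - θ₀) i
    have h2 := abs_sub_abs_le_abs_sub (θ₀ i) (θ i)
    rw [abs_sub_comm] at h2
    exact h2.trans h1
  · rw [not_not.1 h, abs_zero, zero_sub]
    exact neg_nonpos.2 (abs_nonneg _)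

/-- The vector that keeps the coordinates of one group. -/
noncomputable def groupPart (grp : Fin d → Fin m) (k : Fin m) (θ : Param d) : Param d :=
  WithLp.toLp 2 fun i => if grp i = k then θ i else 0

theorem groupL2_eq_norm (k : Fin m) (θ : Param d) : groupL2 grp k θ = ‖groupPart grp k θ‖ := by
  rw [groupL2, EuclideanSpace.norm_eq, Finset.sum_filter]
  congr 1
  refine Finset.sum_congr rfl fun i _ => ?_
  by_cases h : grp i = k <;> simp [groupPart, h]

theorem groupL2_sub_le (k : Fin m) (θ : Param d) :
    groupL2 grp k θ₀ - groupL2 grp k θ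
      ≤ ((activeSet θ₀).filter fun i => grp i = k).card * ‖θ - θ₀‖ := by
  rcases ((activeSet θ₀).filter fun i => grp i = k).eq_empty_or_nonempty with h | h
  · have hz : groupL2 grp k θ₀ = 0 := by
      rw [groupL2, Finset.sum_eq_zero, Real.sqrt_zero]
      intro i hi
      have : i ∉ (activeSet θ₀).filter fun i => grp i = k := by rw [h]; exact Finset.notMem_empty _
      simp only [activeSet, Finset.mem_filter, Finset.mem_univ, true_and] at this hi
      have h0 : θ₀ i = 0 := by
        by_contra hne
        exact this ⟨hne, hi⟩
      rw [h0, zero_pow two_ne_zero]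
    rw [h, hz, Finset.card_empty, Nat.cast_zero, zero_mul, zero_sub]
    exact neg_nonpos.2 (Real.sqrt_nonneg _)
  · have hone : (1 : ℝ) ≤ ((activeSet θ₀).filter fun i => grp i = k).card := by
      exact_mod_cast h.card_pos
    have hsub : groupPart grp k θ - groupPart grp k θ₀ = groupPart grp k (θ - θ₀) := by
      ext i
      by_cases h : grp i = k <;> simp [groupPart, h]
    have hle : ‖groupPart grp k (θ - θ₀)‖ ≤ ‖θ - θ₀‖ := by
      rw [EuclideanSpace.norm_eq, EuclideanSpace.norm_eq]
      refine Real.sqrt_le_sqrt (Finset.sum_le_sum fun i _ => ?_)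
      by_cases h : grp i = k <;> simp [groupPart, h, sq_nonneg]
    have htri := norm_sub_norm_le (groupPart grp k θ₀) (groupPart grp k θ)
    rw [norm_sub_rev, hsub] at htri
    rw [groupL2_eq_norm, groupL2_eq_norm]
    exact (htri.trans hle).trans (le_mul_of_one_le_left (norm_nonneg _) hone)

theorem penaltyL1_sub_le {T : ℕ} {lam : ℝ} (hlam : 0 ≤ lam) {α : Fin m → ℝ} (hα : ∀ k, 0 ≤ α k)
    (θ : Param d) : penaltyL1 grp T lam α θ₀ - penaltyL1 grp T lam α θ
      ≤ lam * (T : ℝ)⁻¹ * activeWeight θ₀ α * ‖θ - θ₀‖ := by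
  rw [penaltyL1, penaltyL1, ← mul_sub, ← Finset.sum_sub_distrib, mul_assoc _ (activeWeight _ _)]
  refine mul_le_mul_of_nonneg_left (sum_le_activeWeight_mul (grp := grp) (norm_nonneg _)
    fun k => ?_) (by positivity)
  rw [← mul_sub, mul_left_comm]
  exact mul_le_mul_of_nonneg_left (groupL1_sub_le k θ) (hα k)

theorem penaltyL2_sub_le {T : ℕ} {gam : ℝ} (hgam : 0 ≤ gam) {ξ : Fin m → ℝ} (hξ : ∀ k, 0 ≤ ξ k)
    (θ : Param d) : penaltyL2 grp T gam ξ θ₀ - penaltyL2 grp T gam ξ θ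
      ≤ gam * (T : ℝ)⁻¹ * activeWeight θ₀ ξ * ‖θ - θ₀‖ := by
  rw [penaltyL2, penaltyL2, ← mul_sub, ← Finset.sum_sub_distrib, mul_assoc _ (activeWeight _ _)]
  refine mul_le_mul_of_nonneg_left (sum_le_activeWeight_mul (grp := grp) (norm_nonneg _)
    fun k => ?_) (by positivity)
  rw [← mul_sub, mul_left_comm]
  exact mul_le_mul_of_nonneg_left (groupL2_sub_le k θ) (hξ k)

end Penalty

/-! ### The deterministic bound -/

section Deterministic

variable {X : Type*} {d m : ℕ} {grp : Fin d → Fin m} {Θ : Set (Param d)} {θ₀ : Param d}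
  {l : X → Param d → ℝ}

/-- The gradient of the empirical criterion at `θ₀`. -/
noncomputable def empScore (Θ : Set (Param d)) (θ₀ : Param d) (l : X → Param d → ℝ) (x : ℕ → X)
    (T : ℕ) (i : Fin d) : ℝ :=
  (T : ℝ)⁻¹ * ∑ t ∈ Finset.Icc 1 T, pderiv Θ i (l (x t)) θ₀

/-- The Hessian of the empirical criterion at `θ₀`. -/
noncomputable def empHessian (Θ : Set (Param d)) (θ₀ : Param d) (l : X → Param d → ℝ) (x : ℕ → X)
    (T : ℕ) (i j : Fin d) : ℝ :=
  (T : ℝ)⁻¹ * ∑ t ∈ Finset.Icc 1 T, pderiv Θ i (pderiv Θ j (l (x t))) θ₀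

/-- The average of the remainders of the loss along a path. -/
noncomputable def empRemainder (Θ : Set (Param d)) (θ₀ : Param d) (l : X → Param d → ℝ)
    (x : ℕ → X) (T : ℕ) (θ : Param d) : ℝ :=
  (T : ℝ)⁻¹ * ∑ t ∈ Finset.Icc 1 T, remainder Θ θ₀ (l (x t)) θ

theorem empCriterion_sub_eq (x : ℕ → X) (T : ℕ) (θ : Param d) :
    empCriterion l x T θ - empCriterion l x T θ₀
      = empRemainder Θ θ₀ l x T θ + ∑ i, (θ i - θ₀ i) * empScore Θ θ₀ l x T i := by
  have h : ∑ i, (θ i - θ₀ i) * empScore Θ θ₀ l x T i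
      = (T : ℝ)⁻¹ * ∑ t ∈ Finset.Icc 1 T, ∑ i, (θ i - θ₀ i) * pderiv Θ i (l (x t)) θ₀ := by
    rw [Finset.sum_comm, Finset.mul_sum]
    refine Finset.sum_congr rfl fun i _ => ?_
    rw [empScore, ← Finset.mul_sum]
    ring
  rw [h, empCriterion, empCriterion, empRemainder, ← mul_sub, ← mul_add,
    ← Finset.sum_sub_distrib, ← Finset.sum_add_distrib]
  congr 1
  refine Finset.sum_congr rfl fun t _ => ?_
  rw [remainder]
  ring

/-- A minimizer of the penalized criterion has a remainder that is at most linear in its distance to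
`θ₀`, with the score and the penalties as slope. -/
theorem empRemainder_le_of_isMinOn {x : ℕ → X} {T : ℕ} {lam gam : ℝ} {α ξ : Fin m → ℝ}
    (hlam : 0 ≤ lam) (hgam : 0 ≤ gam) (hα : ∀ k, 0 ≤ α k) (hξ : ∀ k, 0 ≤ ξ k) (hθ : θ₀ ∈ Θ)
    {θ : Param d} (hmin : IsMinOn (sglCriterion grp l x T lam gam α ξ) Θ θ) :
    empRemainder Θ θ₀ l x T θ ≤ (∑ i, |empScore Θ θ₀ l x T i|
      + lam * (T : ℝ)⁻¹ * activeWeight θ₀ α + gam * (T : ℝ)⁻¹ * activeWeight θ₀ ξ)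
        * ‖θ - θ₀‖ := by
  have h1 : sglCriterion grp l x T lam gam α ξ θ ≤ sglCriterion grp l x T lam gam α ξ θ₀ := hmin hθ
  simp only [sglCriterion] at h1
  have h2 := penaltyL1_sub_le (grp := grp) (θ₀ := θ₀) (T := T) hlam hα θ
  have h3 := penaltyL2_sub_le (grp := grp) (θ₀ := θ₀) (T := T) hgam hξ θ
  have h4 := empCriterion_sub_eq (Θ := Θ) (θ₀ := θ₀) (l := l) x T θ
  have h5 : -∑ i, (θ i - θ₀ i) * empScore Θ θ₀ l x T i
      ≤ (∑ i, |empScore Θ θ₀ l x T i|) * ‖θ - θ₀‖ := by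
    rw [← Finset.sum_neg_distrib, Finset.sum_mul]
    refine Finset.sum_le_sum fun i _ => ?_
    calc _ ≤ |(θ i - θ₀ i) * empScore Θ θ₀ l x T i| := neg_le_abs _
      _ = |empScore Θ θ₀ l x T i| * |(θ - θ₀) i| := by rw [abs_mul, mul_comm]; rfl
      _ ≤ _ := mul_le_mul_of_nonneg_left (abs_coord_le _ i) (abs_nonneg _)
  rw [add_mul, add_mul]
  linarith

/-- Localization by convexity: a linear bound of the remainder at `θ` and a quadratic lower bound in
a ball that is large compared with the slope confine `θ` to a smaller ball. -/
theorem norm_sub_le_of_quadratic_growth {x : ℕ → X} {T : ℕ} (hconv : ∀ x, ConvexOn ℝ Θ (l x))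
    (hθ : θ₀ ∈ Θ) {θ : Param d} (hmem : θ ∈ Θ) {c ρ s : ℝ} (hρ : 0 < ρ)
    (hlin : empRemainder Θ θ₀ l x T θ ≤ s * ‖θ - θ₀‖)
    (hquad : ∀ θ' ∈ Θ, ‖θ' - θ₀‖ ≤ ρ → c * ‖θ' - θ₀‖ ^ 2 ≤ empRemainder Θ θ₀ l x T θ')
    (hs0 : 0 ≤ s) (hs : s < c * ρ) : c * ‖θ - θ₀‖ ≤ s := by
  rcases eq_or_ne θ θ₀ with rfl | hne
  · simpa using hs0
  have hpos : 0 < ‖θ - θ₀‖ := norm_pos_iff.2 (sub_ne_zero.2 hne)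
  rcases le_or_gt ‖θ - θ₀‖ ρ with hle | hgt
  · have h := (hquad θ hmem hle).trans hlin
    rw [sq, ← mul_assoc] at h
    exact le_of_mul_le_mul_right h hpos
  -- Far from `θ₀`, shrink `θ` towards `θ₀` onto the sphere of radius `ρ`.
  · exfalso
    set r := ρ / ‖θ - θ₀‖ with hr
    have hrmem : r ∈ Set.Icc (0 : ℝ) 1 := ⟨by positivity, (div_le_one hpos).2 hgt.le⟩
    have hnorm : ‖θ₀ + r • (θ - θ₀) - θ₀‖ = ρ := by
      rw [add_sub_cancel_left, norm_smul, Real.norm_of_nonneg hrmem.1, hr,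
        div_mul_cancel₀ _ hpos.ne']
    have h1 := hquad (θ₀ + r • (θ - θ₀))
      ((hconv (x 0)).1.add_smul_sub_mem hθ hmem hrmem) hnorm.le
    have h2 : empRemainder Θ θ₀ l x T (θ₀ + r • (θ - θ₀)) ≤ r * empRemainder Θ θ₀ l x T θ := by
      rw [empRemainder, empRemainder, mul_left_comm, Finset.mul_sum _ _ r]
      exact mul_le_mul_of_nonneg_left (Finset.sum_le_sum fun t _ =>
        remainder_segment_le (hconv (x t)) hθ hmem hrmem) (by positivity)
    have h3 : r * empRemainder Θ θ₀ l x T θ ≤ s * ρ := by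
      calc _ ≤ r * (s * ‖θ - θ₀‖) := mul_le_mul_of_nonneg_left hlin hrmem.1
        _ = s * ρ := by rw [hr]; field_simp
    rw [hnorm] at h1
    have h4 : c * ρ * ρ ≤ s * ρ := by
      rw [mul_assoc, ← sq]
      exact h1.trans (h2.trans h3)
    exact absurd (le_of_mul_le_mul_right h4 hρ) (not_le.2 hs)

/-- The remainder grows quadratically near `θ₀` as soon as the empirical Hessian is close to a
positive definite matrix and the average defect is small. Half of the quadratic form contributes
`2 * c`, of which the deviation of the Hessian and the defect cost `c / 2` each. -/
theorem quadratic_growth {x : ℕ → X} {T : ℕ} (hT : 1 ≤ T) {H : Fin d → Fin d → ℝ} {c : ℝ}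
    (hH : ∀ u : Param d, 4 * c * ‖u‖ ^ 2 ≤ ∑ i, ∑ j, u i * u j * H i j)
    (hclose : ∑ i, ∑ j, |empHessian Θ θ₀ l x T i j - H i j| ≤ c)
    {θ : Param d} (hdef : ∑ t ∈ Finset.Icc 1 T, defect Θ θ₀ (l (x t)) θ ≤ c / 2 * T) :
    c * ‖θ - θ₀‖ ^ 2 ≤ empRemainder Θ θ₀ l x T θ := by
  rcases eq_or_ne θ θ₀ with rfl | hne
  · simp [empRemainder, remainder_self]
  have hT0 : (0 : ℝ) < T := by exact_mod_cast hT
  set u := θ - θ₀ with hu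
  have hpos : 0 < ‖u‖ ^ 2 := pow_pos (norm_pos_iff.2 (sub_ne_zero.2 hne)) 2
  have hrem : ∀ t, remainder Θ θ₀ (l (x t)) θ
      = hessQuad Θ θ₀ (l (x t)) u / 2 - defect Θ θ₀ (l (x t)) θ * ‖u‖ ^ 2 := fun t => by
    rw [defect, ← hu, div_mul_cancel₀ _ hpos.ne']
    ring
  have hquad : (T : ℝ)⁻¹ * ∑ t ∈ Finset.Icc 1 T, hessQuad Θ θ₀ (l (x t)) u
      = ∑ i, ∑ j, u i * u j * empHessian Θ θ₀ l x T i j := by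
    simp only [hessQuad]
    rw [Finset.sum_comm, Finset.mul_sum]
    refine Finset.sum_congr rfl fun i _ => ?_
    rw [Finset.sum_comm, Finset.mul_sum]
    refine Finset.sum_congr rfl fun j _ => ?_
    rw [empHessian, ← Finset.mul_sum]
    ring
  have hdiff : ∑ i, ∑ j, u i * u j * H i j - ∑ i, ∑ j, u i * u j * empHessian Θ θ₀ l x T i j
      ≤ c * ‖u‖ ^ 2 := by
    rw [← Finset.sum_sub_distrib]
    refine le_trans ?_ (mul_le_mul_of_nonneg_right hclose hpos.le)
    rw [Finset.sum_mul]
    refine Finset.sum_le_sum fun i _ => ?_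
    rw [← Finset.sum_sub_distrib, Finset.sum_mul]
    refine Finset.sum_le_sum fun j _ => ?_
    calc _ = u i * u j * (H i j - empHessian Θ θ₀ l x T i j) := by ring
      _ ≤ |u i * u j * (H i j - empHessian Θ θ₀ l x T i j)| := le_abs_self _
      _ = |empHessian Θ θ₀ l x T i j - H i j| * (|u i| * |u j|) := by
        rw [abs_mul, abs_mul, abs_sub_comm, mul_comm]
      _ ≤ _ := by
        rw [sq]
        gcongr <;> exact abs_coord_le u _
  have hemp : empRemainder Θ θ₀ l x T θ = (∑ i, ∑ j, u i * u j * empHessian Θ θ₀ l x T i j) / 2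
      - (T : ℝ)⁻¹ * (∑ t ∈ Finset.Icc 1 T, defect Θ θ₀ (l (x t)) θ) * ‖u‖ ^ 2 := by
    rw [empRemainder, ← hquad]
    simp only [hrem]
    rw [Finset.sum_sub_distrib, ← Finset.sum_mul, ← Finset.sum_div]
    ring
  have hd : (T : ℝ)⁻¹ * (∑ t ∈ Finset.Icc 1 T, defect Θ θ₀ (l (x t)) θ) ≤ c / 2 := by
    rw [inv_mul_le_iff₀ hT0]
    linarith
  have hd' := mul_le_mul_of_nonneg_right hd hpos.le
  rw [hemp]
  linarith [hH u]

end Deterministic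

/-! ### Bounds in probability -/

section Probability

variable {Ω X : Type*} [mΩ : MeasurableSpace Ω] [MeasurableSpace X] {P : Measure Ω} {ε : ℕ → Ω → X}

/-- Martingale differences are orthogonal. -/
theorem IsSqIntMartingaleDiff.integral_sq_sum [IsProbabilityMeasure P] {ℱ : Filtration ℕ mΩ}
    {Y : ℕ → Ω → ℝ} (hY : IsSqIntMartingaleDiff P ℱ Y) (T : ℕ) :
    ∫ ω, (∑ t ∈ Finset.Icc 1 T, Y t ω) ^ 2 ∂P = ∑ t ∈ Finset.Icc 1 T, ∫ ω, Y t ω ^ 2 ∂P := by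
  induction T with
  | zero => simp
  | succ T ih =>
    set A : Ω → ℝ := fun ω => ∑ t ∈ Finset.Icc 1 T, Y t ω with hA
    obtain ⟨_, hYL, hYc⟩ := hY (T + 1) (by omega)
    rw [Nat.add_sub_cancel] at hYc
    have hAL : MemLp A 2 P := memLp_finsetSum _ fun t ht => (hY t (Finset.mem_Icc.1 ht).1).2.1
    have hAm : Measurable[ℱ T] A := Finset.measurable_sum _ fun t ht =>
      (hY t (Finset.mem_Icc.1 ht).1).1.mono (ℱ.mono (Finset.mem_Icc.1 ht).2) le_rfl
    have hAY : Integrable (A * Y (T + 1)) P := hAL.integrable_mul hYL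
    have hcross : ∫ ω, (A * Y (T + 1)) ω ∂P = 0 := by
      rw [← integral_condExp (ℱ.le T)]
      refine integral_eq_zero_of_ae ?_
      refine (condExp_mul_of_stronglyMeasurable_left hAm.stronglyMeasurable hAY
        (hYL.integrable one_le_two)).trans ?_
      filter_upwards [hYc] with ω hω
      simp [hω]
    have hexp : ∀ ω, (∑ t ∈ Finset.Icc 1 (T + 1), Y t ω) ^ 2
        = A ω ^ 2 + 2 * (A * Y (T + 1)) ω + Y (T + 1) ω ^ 2 := by
      intro ω
      rw [Finset.sum_Icc_succ_top (by omega), Pi.mul_apply]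
      ring
    simp only [hexp]
    have hsum : Integrable (fun ω => A ω ^ 2 + 2 * (A * Y (T + 1)) ω) P :=
      hAL.integrable_sq.add (hAY.const_mul 2)
    rw [integral_add hsum hYL.integrable_sq,
      integral_add hAL.integrable_sq (hAY.const_mul 2), integral_const_mul, hcross, mul_zero,
      add_zero, ih, Finset.sum_Icc_succ_top (by omega)]

/-- Chebyshev's inequality for the average of a stationary martingale difference. -/
theorem measure_average_ge_le [IsProbabilityMeasure P] (h : StationaryErgodic P ε)
    (hε : ∀ t, Measurable (ε t)) {ℱ : Filtration ℕ mΩ} {g : X → ℝ} (hg : Measurable g)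
    (hY : IsSqIntMartingaleDiff P ℱ fun t ω => g (ε t ω)) {M : ℝ} (hM : 0 < M) {T : ℕ}
    (hT : 1 ≤ T) :
    P {ω | M * (T : ℝ) ^ (-(1 / 2) : ℝ) ≤ |(T : ℝ)⁻¹ * ∑ t ∈ Finset.Icc 1 T, g (ε t ω)|}
      ≤ ENNReal.ofReal ((∫ ω, g (ε 1 ω) ^ 2 ∂P) / M ^ 2) := by
  have hT0 : (0 : ℝ) < T := by exact_mod_cast hT
  set A : Ω → ℝ := fun ω => ∑ t ∈ Finset.Icc 1 T, g (ε t ω) with hA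
  have hAL : MemLp A 2 P := memLp_finsetSum _ fun t ht => (hY t (Finset.mem_Icc.1 ht).1).2.1
  have hlaw : ∀ t, ∫ ω, g (ε t ω) ^ 2 ∂P = ∫ ω, g (ε 1 ω) ^ 2 ∂P := by
    have h0 : ∀ t, ∫ ω, g (ε t ω) ^ 2 ∂P = ∫ x, g x ^ 2 ∂(P.map (ε t)) := fun t =>
      (integral_map (hε t).aemeasurable (hg.pow_const 2).aestronglyMeasurable).symm
    intro t
    rw [h0, h0, h.map_eq hε, h.map_eq hε 1]
  have hsq : ∫ ω, A ω ^ 2 ∂P = T * ∫ ω, g (ε 1 ω) ^ 2 ∂P := by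
    rw [hA, hY.integral_sq_sum T, Finset.sum_congr rfl fun t _ => hlaw t]
    simp
  have hmarkov := mul_meas_ge_le_integral_of_nonneg (μ := P) (f := fun ω => A ω ^ 2)
    (ae_of_all _ fun ω => sq_nonneg _) hAL.integrable_sq (M ^ 2 * T)
  rw [hsq] at hmarkov
  have hset : {ω | M * (T : ℝ) ^ (-(1 / 2) : ℝ) ≤ |(T : ℝ)⁻¹ * A ω|}
      ⊆ {ω | M ^ 2 * T ≤ A ω ^ 2} := by
    intro ω hω
    have hω : M * (T : ℝ) ^ (-(1 / 2) : ℝ) ≤ |(T : ℝ)⁻¹ * A ω| := hω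
    have hhalf : ((T : ℝ) ^ (-(1 / 2) : ℝ)) ^ 2 = (T : ℝ)⁻¹ := by
      rw [← Real.rpow_natCast, ← Real.rpow_mul hT0.le, ← Real.rpow_neg_one]
      norm_num
    have h2 := pow_le_pow_left₀ (by positivity) hω 2
    rw [mul_pow, hhalf, sq_abs, mul_pow] at h2
    have h3 := mul_le_mul_of_nonneg_left h2 (sq_nonneg (T : ℝ))
    change M ^ 2 * T ≤ A ω ^ 2
    calc M ^ 2 * T = (T : ℝ) ^ 2 * (M ^ 2 * (T : ℝ)⁻¹) := by field_simp
      _ ≤ (T : ℝ) ^ 2 * ((T : ℝ)⁻¹ ^ 2 * A ω ^ 2) := h3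
      _ = A ω ^ 2 := by field_simp
  refine (measure_mono hset).trans ?_
  rw [← ofReal_measureReal]
  refine ENNReal.ofReal_le_ofReal ?_
  rw [le_div_iff₀ (by positivity)]
  refine le_of_mul_le_mul_left ?_ hT0
  linarith

/-- Markov's inequality for the average of a nonnegative function of a stationary process. -/
theorem measure_sum_ge_le (h : StationaryErgodic P ε) (hε : ∀ t, Measurable (ε t))
    {ψ : X → ℝ≥0∞} (hψ : Measurable ψ) {a b : ℝ} (ha : 0 < a)
    (hmean : ∫⁻ ω, ψ (ε 1 ω) ∂P ≤ ENNReal.ofReal (a * b)) {T : ℕ} (hT : 1 ≤ T) :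
    P {ω | ENNReal.ofReal (a * T) ≤ ∑ t ∈ Finset.Icc 1 T, ψ (ε t ω)} ≤ ENNReal.ofReal b := by
  have hT0 : (0 : ℝ) < T := by exact_mod_cast hT
  have hlaw : ∀ t, ∫⁻ ω, ψ (ε t ω) ∂P = ∫⁻ ω, ψ (ε 1 ω) ∂P := by
    have h0 : ∀ t, ∫⁻ ω, ψ (ε t ω) ∂P = ∫⁻ x, ψ x ∂(P.map (ε t)) := fun t =>
      (lintegral_map hψ (hε t)).symm
    intro t
    rw [h0, h0, h.map_eq hε, h.map_eq hε 1]
  have hmeas : ∀ t, Measurable fun ω => ψ (ε t ω) := fun t => hψ.comp (hε t)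
  have haT : ENNReal.ofReal (a * T) ≠ 0 := by
    rw [Ne, ENNReal.ofReal_eq_zero, not_le]; positivity
  refine (meas_ge_le_lintegral_div (Finset.measurable_sum _ fun t _ => hmeas t).aemeasurable haT
    ENNReal.ofReal_ne_top).trans ?_
  rw [lintegral_finsetSum _ fun t _ => hmeas t, Finset.sum_congr rfl fun t _ => hlaw t]
  simp only [Finset.sum_const, Nat.card_Icc, Nat.add_sub_cancel, nsmul_eq_mul]
  refine ENNReal.div_le_of_le_mul ?_
  calc (T : ℝ≥0∞) * ∫⁻ ω, ψ (ε 1 ω) ∂P ≤ ENNReal.ofReal T * ENNReal.ofReal (a * b) := by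
        rw [ENNReal.ofReal_natCast]; gcongr
    _ = ENNReal.ofReal b * ENNReal.ofReal (a * T) := by
        rw [← ENNReal.ofReal_mul hT0.le, mul_comm (ENNReal.ofReal b),
          ← ENNReal.ofReal_mul (by positivity)]
        congr 1
        ring

variable {d : ℕ} {Θ : Set (Param d)} {θ₀ : Param d} {l : X → Param d → ℝ}

theorem measurable_defectSup (hconv : Convex ℝ Θ) (hint : (interior Θ).Nonempty)
    (hmeas : ∀ θ ∈ Θ, Measurable fun x => l x θ)
    (hl : ∀ x, ContDiffOn ℝ ((⊤ : ℕ∞) : WithTop ℕ∞) (l x) Θ) (hθ : θ₀ ∈ Θ)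
    {S : Set (Param d)} (hS : S ⊆ Θ) (hcount : S.Countable) (ρ : ℝ) :
    Measurable fun x => defectSup Θ θ₀ S ρ (l x) := by
  have hΘ := uniqueDiffOn_convex hconv hint
  have h1 : ∀ i, ∀ θ ∈ Θ, Measurable fun x => pderiv Θ i (l x) θ := fun i θ hmem =>
    measurable_pderiv hconv hint hmeas (fun x => (hl x).differentiableOn (by simp)) hmem i
  have h2 : ∀ i j, Measurable fun x => pderiv Θ i (pderiv Θ j (l x)) θ₀ := fun i j =>
    measurable_pderiv hconv hint (h1 j)
      (fun x => (contDiffOn_pderiv hΘ (hl x) j).differentiableOn (by simp)) hθ i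
  refine Measurable.biSup _ (hcount.mono Set.inter_subset_left) fun θ hmem => ?_
  refine ENNReal.measurable_ofReal.comp (Measurable.div_const (Measurable.sub ?_ ?_) _)
  · exact (Finset.measurable_sum _ fun i _ => Finset.measurable_sum _ fun j _ =>
      (h2 i j).const_mul _).div_const _
  · exact ((hmeas θ (hS hmem.1)).sub (hmeas θ₀ hθ)).sub
      (Finset.measurable_sum _ fun i _ => (h1 i θ₀ hθ).const_mul _)

/-- The mean of the defect vanishes as the radius shrinks, by dominated convergence: the Hessian at
`θ₀` is an integrable majorant. -/
theorem tendsto_lintegral_defectSup (hε : Measurable (ε 1)) (hconv : Convex ℝ Θ)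
    (hint : (interior Θ).Nonempty) (hmeas : ∀ θ ∈ Θ, Measurable fun x => l x θ)
    (hlconv : ∀ x, ConvexOn ℝ Θ (l x))
    (hl : ∀ x, ContDiffOn ℝ ((⊤ : ℕ∞) : WithTop ℕ∞) (l x) Θ) (hθ : θ₀ ∈ Θ)
    (hhess : ∀ i j, Integrable (fun ω => pderiv Θ i (pderiv Θ j (l (ε 1 ω))) θ₀) P)
    {S : Set (Param d)} (hS : S ⊆ Θ) (hcount : S.Countable) :
    Tendsto (fun n : ℕ => ∫⁻ ω, defectSup Θ θ₀ S ((n : ℝ) + 1)⁻¹ (l (ε 1 ω)) ∂P) atTop (𝓝 0) := by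
  have hΘ := uniqueDiffOn_convex hconv hint
  have hsize : Integrable (fun ω => hessSize Θ θ₀ (l (ε 1 ω))) P :=
    integrable_finsetSum _ fun i _ => integrable_finsetSum _ fun j _ => (hhess i j).abs
  have hlim := tendsto_lintegral_of_dominated_convergence (μ := P) (f := fun _ => 0)
    (F := fun (n : ℕ) ω => defectSup Θ θ₀ S ((n : ℝ) + 1)⁻¹ (l (ε 1 ω)))
    (fun ω => ENNReal.ofReal (hessSize Θ θ₀ (l (ε 1 ω))))
    (fun n => (measurable_defectSup hconv hint hmeas hl hθ hS hcount _).comp hε)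
    (fun n => ae_of_all _ fun ω => defectSup_le_hessSize (hlconv _)
      ((hl _).differentiableOn (by simp) θ₀ hθ) hθ hS _)
    hsize.lintegral_lt_top.ne
    (ae_of_all _ fun ω => tendsto_defectSup hconv hΘ hθ (hl _) hS)
  simpa using hlim

/-- A positive definite matrix has a positive lower bound on its quadratic form. -/
theorem exists_pos_le_quadForm {H : Matrix (Fin d) (Fin d) ℝ} (hH : H.PosDef) :
    ∃ c > 0, ∀ u : Param d, 4 * c * ‖u‖ ^ 2 ≤ ∑ i, ∑ j, u i * u j * H i j := by
  have hpos : ∀ u : Param d, u ≠ 0 → 0 < ∑ i, ∑ j, u i * u j * H i j := by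
    intro u hu
    have h := hH.dotProduct_mulVec_pos (x := u.ofLp) (by simpa using hu)
    simp only [dotProduct, Matrix.mulVec, Pi.star_apply, star_trivial, Finset.mul_sum] at h
    refine h.trans_eq (Finset.sum_congr rfl fun i _ => Finset.sum_congr rfl fun j _ => ?_)
    ring
  have hcont : Continuous fun u : Param d => ∑ i, ∑ j, u i * u j * H i j := by fun_prop
  -- The unit sphere is empty for `d = 0`; otherwise the form attains its minimum on it.
  rcases (Metric.sphere (0 : Param d) 1).eq_empty_or_nonempty with hempty | hne
  · refine ⟨1, one_pos, fun u => ?_⟩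
    rcases eq_or_ne u 0 with rfl | hu
    · simp
    · exfalso
      have : ‖u‖⁻¹ • u ∈ Metric.sphere (0 : Param d) 1 := by
        rw [mem_sphere_zero_iff_norm, norm_smul, norm_inv, norm_norm,
          inv_mul_cancel₀ (norm_ne_zero_iff.2 hu)]
      rw [hempty] at this
      exact this
  · obtain ⟨v, hv, hmin⟩ := (isCompact_sphere (0 : Param d) 1).exists_isMinOn hne hcont.continuousOn
    set q := ∑ i, ∑ j, v i * v j * H i j with hq
    have hv0 : v ≠ 0 := by
      rintro rfl
      simp at hv
    refine ⟨q / 4, by have := hpos v hv0; positivity, fun u => ?_⟩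
    rcases eq_or_ne u 0 with rfl | hu
    · simp
    have hn := norm_pos_iff.2 hu
    have hmem : ‖u‖⁻¹ • u ∈ Metric.sphere (0 : Param d) 1 := by
      rw [mem_sphere_zero_iff_norm, norm_smul, norm_inv, norm_norm, inv_mul_cancel₀ hn.ne']
    have h := hmin hmem
    simp only [Set.mem_ofPred_eq, PiLp.smul_apply, smul_eq_mul] at h
    have hscale : ∑ i, ∑ j, ‖u‖⁻¹ * u i * (‖u‖⁻¹ * u j) * H i j
        = (∑ i, ∑ j, u i * u j * H i j) / ‖u‖ ^ 2 := by
      rw [Finset.sum_div]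
      refine Finset.sum_congr rfl fun i _ => ?_
      rw [Finset.sum_div]
      refine Finset.sum_congr rfl fun j _ => ?_
      field_simp
    rw [hscale, le_div_iff₀ (by positivity)] at h
    linarith

theorem ofReal_sum_le {ι : Type*} (s : Finset ι) (f : ι → ℝ) :
    ENNReal.ofReal (∑ i ∈ s, f i) ≤ ∑ i ∈ s, ENNReal.ofReal (f i) :=
  Finset.le_sum_of_subadditive _ ENNReal.ofReal_zero.le (fun _ _ => ENNReal.ofReal_add_le) s f

end Probability

/-! ### The rate of convergence -/

section Rate

variable {d m : ℕ} {θ₀ : Param d} {lam gam : ℕ → ℝ} {α ξ : ℕ → Fin m → ℝ}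

theorem tendsto_sglRate
    (h_a : Tendsto (fun T : ℕ => lam T * (T : ℝ)⁻¹ * activeWeight θ₀ (α T)) atTop (𝓝 0))
    (h_b : Tendsto (fun T : ℕ => gam T * (T : ℝ)⁻¹ * activeWeight θ₀ (ξ T)) atTop (𝓝 0)) :
    Tendsto (sglRate θ₀ lam gam α ξ) atTop (𝓝 0) := by
  have h : Tendsto (fun T : ℕ => (T : ℝ) ^ (-(1 / 2) : ℝ)) atTop (𝓝 0) :=
    (tendsto_rpow_neg_atTop (by norm_num : (0 : ℝ) < 1 / 2)).comp tendsto_natCast_atTop_atTop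
  have hsum := (h.add h_a).add h_b
  rw [add_zero, add_zero] at hsum
  exact hsum

end Rate

end SGL

theorem mainTheorem5 {Ω X : Type*} [mΩ : MeasurableSpace Ω] [MeasurableSpace X]
    (P : Measure Ω) [IsProbabilityMeasure P]
    {d m : ℕ} (grp : Fin d → Fin m)
    (Θ : Set (SGL.Param d)) (θ₀ : SGL.Param d)
    (l : X → SGL.Param d → ℝ) (ε : ℕ → Ω → X) (ℱ : Filtration ℕ mΩ)
    (lam gam : ℕ → ℝ) (α ξ : ℕ → Fin m → ℝ) (θhat : ℕ → Ω → SGL.Param d)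
    -- the process is nonanticipative, strictly stationary and ergodic
    (h_adapted : ∀ t, Measurable[ℱ t] (ε t))
    (h_erg : SGL.StationaryErgodic P ε)
    -- the parameter set
    (hΘ_convex : Convex ℝ Θ) (hΘ_int : (interior Θ).Nonempty)
    -- the loss
    (hl_meas : ∀ θ ∈ Θ, Measurable (fun x => l x θ))
    (hl_convex : ∀ x, StrictConvexOn ℝ Θ (l x))
    (hl_smooth : ∀ x, ContDiffOn ℝ ((⊤ : ℕ∞) : WithTop ℕ∞) (l x) Θ)
    -- the true parameter, the score and the Hessian there
    (h_true : SGL.IsTrueParameter P Θ l ε θ₀)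
    (h_score : ∀ i, SGL.IsSqIntMartingaleDiff P ℱ
      (fun t ω => SGL.pderiv Θ i (l (ε t ω)) θ₀))
    (h_hess_int : ∀ t, 1 ≤ t → ∀ i j,
      Integrable (fun ω => SGL.pderiv Θ i (SGL.pderiv Θ j (l (ε t ω))) θ₀) P)
    (h_hess_pos : ∀ t, 1 ≤ t → (SGL.expHessian P Θ l ε θ₀ t).PosDef)
    -- the third-order moment assumption, for one fixed constant
    (C : ℝ) (hC : 0 < C)
    (h_third : ∀ᶠ T in atTop,
      SGL.thirdOrderMoment P Θ θ₀ l ε T (C * SGL.sglRate θ₀ lam gam α ξ T) < ∞)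
    -- the tuning parameters and the weights
    (h_lam : ∀ T, 0 ≤ lam T) (h_gam : ∀ T, 0 ≤ gam T)
    (hα : ∀ T k, 0 ≤ α T k) (hξ : ∀ T k, 0 ≤ ξ T k)
    (h_lam_o : lam =o[atTop] (fun T : ℕ => (T : ℝ)))
    (h_gam_o : gam =o[atTop] (fun T : ℕ => (T : ℝ)))
    (h_a : Tendsto (fun T : ℕ => lam T * (T : ℝ)⁻¹ * SGL.activeWeight θ₀ (α T)) atTop (𝓝 0))
    (h_b : Tendsto (fun T : ℕ => gam T * (T : ℝ)⁻¹ * SGL.activeWeight θ₀ (ξ T)) atTop (𝓝 0))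
    -- the penalized estimator
    (h_est : ∀ T, 1 ≤ T → ∀ᵐ ω ∂P, θhat T ω ∈ Θ ∧
      IsMinOn (SGL.sglCriterion grp l (fun t => ε t ω) T (lam T) (gam T) (α T) (ξ T)) Θ
        (θhat T ω)) :
    SGL.IsBigOp P (fun T ω => ‖θhat T ω - θ₀‖) (SGL.sglRate θ₀ lam gam α ξ) := by

  obtain ⟨hθ, -⟩ := h_true
  have hΘ := uniqueDiffOn_convex hΘ_convex hΘ_int
  have hε : ∀ t, Measurable (ε t) := fun t => (h_adapted t).mono (ℱ.le t) le_rfl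
  have hlc : ∀ x, ConvexOn ℝ Θ (l x) := fun x => (hl_convex x).convexOn
  have hm1 : ∀ i, ∀ θ ∈ Θ, Measurable fun x => SGL.pderiv Θ i (l x) θ := fun i θ hmem =>
    SGL.measurable_pderiv hΘ_convex hΘ_int hl_meas
      (fun x => (hl_smooth x).differentiableOn (by simp)) hmem i
  have hm2 : ∀ i j, Measurable fun x => SGL.pderiv Θ i (SGL.pderiv Θ j (l x)) θ₀ := fun i j =>
    SGL.measurable_pderiv hΘ_convex hΘ_int (hm1 j)
      (fun x => (SGL.contDiffOn_pderiv hΘ (hl_smooth x) j).differentiableOn (by simp)) hθ i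
  obtain ⟨S, hSΘ, hScount, hSdense⟩ :=
    (TopologicalSpace.IsSeparable.of_separableSpace Θ).exists_countable_dense_subset
  obtain ⟨c, hc, hH⟩ := SGL.exists_pos_le_quadForm (h_hess_pos 1 le_rfl)
  set H := SGL.expHessian P Θ l ε θ₀ 1 with hHdef
  intro δ hδ
  -- the radius on which the average defect is small with large probability
  obtain ⟨n, hn⟩ := (((SGL.tendsto_lintegral_defectSup (hε 1) hΘ_convex hΘ_int hl_meas hlc
    hl_smooth hθ (h_hess_int 1 le_rfl) hSΘ hScount)).eventually_lt_const
      (ENNReal.ofReal_pos.2 (by positivity : 0 < c / 2 * (δ / 3)))).exists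
  set ρ : ℝ := ((n : ℝ) + 1)⁻¹ with hρdef
  have hρ : 0 < ρ := by positivity
  -- the constant that bounds the rescaled score with large probability
  set V : ℝ := ∑ i, ∫ ω, SGL.pderiv Θ i (l (ε 1 ω)) θ₀ ^ 2 ∂P with hV
  have hV0 : 0 ≤ V := Finset.sum_nonneg fun i _ => integral_nonneg fun ω => sq_nonneg _
  set M : ℝ := 3 * V / δ + 1 with hM
  have hM1 : 1 ≤ M := by
    have : 0 ≤ 3 * V / δ := by positivity
    linarith
  have hM0 : 0 < M := by linarith
  have hVM : V / M ^ 2 ≤ δ / 3 := by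
    have h1 : V ≤ δ / 3 * M := by
      rw [hM]
      have : δ / 3 * (3 * V / δ + 1) = V + δ / 3 := by field_simp
      linarith
    have h2 : M ≤ M ^ 2 := by nlinarith
    rw [div_le_iff₀ (by positivity)]
    exact h1.trans (mul_le_mul_of_nonneg_left h2 (by positivity))
  set K : ℝ := d * M + 1 with hK
  have hK0 : 0 < K := by positivity
  refine ⟨K / c, by positivity, ?_⟩
  -- the Hessian deviates from its mean with vanishing probability
  set η : ℝ := c / (d * d + 1) with hη
  have hη0 : 0 < η := by positivity
  have hHess : Tendsto (fun T : ℕ => ∑ i, ∑ j, P {ω | η ≤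
      |SGL.empHessian Θ θ₀ l (fun t => ε t ω) T i j - H i j|}) atTop (𝓝 0) := by
    have h := tendsto_finsetSum (Finset.univ : Finset (Fin d)) fun i _ =>
      tendsto_finsetSum (Finset.univ : Finset (Fin d)) fun j _ =>
        h_erg.tendsto_measure_average hε (hm2 i j) (h_hess_int 1 le_rfl i j) hη0
    simp only [Finset.sum_const_zero] at h
    exact h
  have hrate := SGL.tendsto_sglRate h_a h_b
  filter_upwards [eventually_ge_atTop 1, hHess.eventually_le_const
    (ENNReal.ofReal_pos.2 (by positivity : 0 < δ / 3)),
    hrate.eventually_lt_const (by positivity : 0 < c * (ρ / 2) / K)] with T hT hHT hrT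
  set B₁ : Set Ω := ⋃ i, {ω | M * (T : ℝ) ^ (-(1 / 2) : ℝ) ≤
    |SGL.empScore Θ θ₀ l (fun t => ε t ω) T i|} with hB₁
  set B₂ : Set Ω := ⋃ i, ⋃ j, {ω | η ≤
    |SGL.empHessian Θ θ₀ l (fun t => ε t ω) T i j - H i j|} with hB₂
  set B₃ : Set Ω := {ω | ENNReal.ofReal (c / 2 * T) ≤
    ∑ t ∈ Finset.Icc 1 T, SGL.defectSup Θ θ₀ S ρ (l (ε t ω))} with hB₃
  have hP₁ : P B₁ ≤ ENNReal.ofReal (δ / 3) := by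
    refine (measure_iUnion_fintype_le P _).trans ?_
    refine (Finset.sum_le_sum fun i _ =>
      SGL.measure_average_ge_le h_erg hε (hm1 i θ₀ hθ) (h_score i) hM0 hT).trans ?_
    rw [← ENNReal.ofReal_sum_of_nonneg fun i _ => div_nonneg (integral_nonneg fun ω => sq_nonneg _)
      (sq_nonneg _), ← Finset.sum_div]
    exact ENNReal.ofReal_le_ofReal hVM
  have hP₂ : P B₂ ≤ ENNReal.ofReal (δ / 3) :=
    ((measure_iUnion_fintype_le P _).trans
      (Finset.sum_le_sum fun i _ => measure_iUnion_fintype_le P _)).trans hHT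
  have hP₃ : P B₃ ≤ ENNReal.ofReal (δ / 3) :=
    SGL.measure_sum_ge_le h_erg hε
      (SGL.measurable_defectSup hΘ_convex hΘ_int hl_meas hl_smooth hθ hSΘ hScount ρ)
      (by positivity) hn.le hT
  have hincl : {ω | K / c * SGL.sglRate θ₀ lam gam α ξ T < |‖θhat T ω - θ₀‖|}
      ≤ᵐ[P] (B₁ ∪ B₂ ∪ B₃ : Set Ω) := by
    filter_upwards [h_est T hT] with ω hω hbad
    have hbad : K / c * SGL.sglRate θ₀ lam gam α ξ T < |‖θhat T ω - θ₀‖| := hbad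
    obtain ⟨hmem, hmin⟩ := hω
    by_contra hgood
    have hgood' : ω ∉ B₁ ∧ ω ∉ B₂ ∧ ω ∉ B₃ := by
      refine ⟨fun h => hgood (Or.inl (Or.inl h)), fun h => hgood (Or.inl (Or.inr h)),
        fun h => hgood (Or.inr h)⟩
    obtain ⟨hg₁, hg₂, hg₃⟩ := hgood'
    simp only [hB₁, Set.mem_iUnion, Set.mem_ofPred_eq, not_exists, not_le] at hg₁
    simp only [hB₂, Set.mem_iUnion, Set.mem_ofPred_eq, not_exists, not_le] at hg₂
    simp only [hB₃, Set.mem_ofPred_eq, not_le] at hg₃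
    set x : ℕ → X := fun t => ε t ω with hx
    have hclose : ∑ i, ∑ j, |SGL.empHessian Θ θ₀ l x T i j - H i j| ≤ c := by
      calc _ ≤ ∑ _i : Fin d, ∑ _j : Fin d, η :=
            Finset.sum_le_sum fun i _ => Finset.sum_le_sum fun j _ => (hg₂ i j).le
        _ = d * d * η := by simp [mul_assoc]
        _ ≤ (d * d + 1) * η := by linarith
        _ = c := by rw [hη]; field_simp
    have hquad : ∀ θ' ∈ Θ, ‖θ' - θ₀‖ ≤ ρ / 2 →
        c * ‖θ' - θ₀‖ ^ 2 ≤ SGL.empRemainder Θ θ₀ l x T θ' := by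
      intro θ' hθ' hnear
      refine SGL.quadratic_growth hT hH hclose ?_
      have hle : ENNReal.ofReal (∑ t ∈ Finset.Icc 1 T, SGL.defect Θ θ₀ (l (x t)) θ')
          ≤ ENNReal.ofReal (c / 2 * T) :=
        ((SGL.ofReal_sum_le _ _).trans (Finset.sum_le_sum fun t _ =>
          SGL.ofReal_defect_le ((hl_smooth _).continuousOn) hSΘ hSdense hθ'
            (by linarith))).trans hg₃.le
      exact (ENNReal.ofReal_le_ofReal_iff (by positivity)).1 hle
    have hlin := SGL.empRemainder_le_of_isMinOn (h_lam T) (h_gam T) (hα T) (hξ T) hθ hmin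
    set s : ℝ := ∑ i, |SGL.empScore Θ θ₀ l x T i|
      + lam T * (T : ℝ)⁻¹ * SGL.activeWeight θ₀ (α T)
      + gam T * (T : ℝ)⁻¹ * SGL.activeWeight θ₀ (ξ T) with hs
    have ha0 : 0 ≤ lam T * (T : ℝ)⁻¹ * SGL.activeWeight θ₀ (α T) :=
      mul_nonneg (mul_nonneg (h_lam T) (by positivity)) (SGL.activeWeight_nonneg (hα T))
    have hb0 : 0 ≤ gam T * (T : ℝ)⁻¹ * SGL.activeWeight θ₀ (ξ T) :=
      mul_nonneg (mul_nonneg (h_gam T) (by positivity)) (SGL.activeWeight_nonneg (hξ T))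
    have hscore0 : 0 ≤ ∑ i, |SGL.empScore Θ θ₀ l x T i| :=
      Finset.sum_nonneg fun i _ => abs_nonneg _
    have hscore : ∑ i, |SGL.empScore Θ θ₀ l x T i| ≤ d * M * (T : ℝ) ^ (-(1 / 2) : ℝ) := by
      calc _ ≤ ∑ _i : Fin d, M * (T : ℝ) ^ (-(1 / 2) : ℝ) :=
            Finset.sum_le_sum fun i _ => (hg₁ i).le
        _ = _ := by simp [mul_assoc]
    have hroot : 0 ≤ (T : ℝ) ^ (-(1 / 2) : ℝ) := by positivity
    have hsK : s ≤ K * SGL.sglRate θ₀ lam gam α ξ T := by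
      have hdM : 0 ≤ d * M := by positivity
      rw [hs, hK, SGL.sglRate]
      nlinarith [mul_nonneg hdM ha0, mul_nonneg hdM hb0]
    have hsρ : s < c * (ρ / 2) := by
      rw [lt_div_iff₀ hK0, mul_comm] at hrT
      exact hsK.trans_lt hrT
    have hfinal := SGL.norm_sub_le_of_quadratic_growth hlc hθ hmem (half_pos hρ) hlin hquad
      (by positivity) hsρ
    rw [abs_of_nonneg (norm_nonneg _), div_mul_eq_mul_div, div_lt_iff₀ hc] at hbad
    linarith
  calc _ ≤ P (B₁ ∪ B₂ ∪ B₃) := measure_mono_ae hincl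
    _ ≤ P B₁ + P B₂ + P B₃ :=
      (measure_union_le _ _).trans (add_le_add_left (measure_union_le _ _) _)
    _ ≤ ENNReal.ofReal (δ / 3) + ENNReal.ofReal (δ / 3) + ENNReal.ofReal (δ / 3) := by gcongr
    _ = ENNReal.ofReal δ := by
      rw [← ENNReal.ofReal_add (by positivity) (by positivity),
        ← ENNReal.ofReal_add (by positivity) (by positivity)]
      congr 1
      ring
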